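/- **Setting.** $\mathcal L$ is the propositional modal language with countably many letters and primitives $\neg,\vee,\Diamond$ ($\Box=\neg\Diamond\neg$); $\mathcal L_\exists$ is its extension by a second modality $\exists$ ($\forall=\neg\exists\neg$); $\mathcal L_Q$ is the predicate modal language with countably many individual variables, countably many predicates of each arity $m\ge 0$ (the $0$-ary ones being the propositional letters), no function symbols, constants or equality, and primitives $\neg,\vee,\Diamond,\exists$. $\mathbf{Grz}$ is the least normal modal logic in $\mathcal L$ containing $p\to\Diamond p$, $\Diamond\Diamond p\to\Diamond p$ and the Grzegorczyk axiom $p\to\Diamond(p\wedge\neg\Diamond(\Diamond p\wedge\neg p))$ (equivalently $\Box(\Box(p\to\Box p)\to p)\to p$). $\mathbf{MGrz}$ (monadic Grzegorczyk logic) is the least set of $\mathcal L_\exists$-formulae containing the theorems of $\mathbf{Grz}$, the $\mathbf{S5}$ axioms for $\exists$ and $\exists\Diamond p\to\Diamond\exists p$, and closed under modus ponens, necessitation for $\Box$ and for $\forall$, and substitution. $\mathbf{QGrz}$ (predicate Grzegorczyk logic) is the least set of $\mathcal L_Q$-formulae containing the axioms of the classical predicate calculus and the theorems of $\mathbf{Grz}$,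 and closed under modus ponens, necessitation, generalization, and uniform substitution of formulae for predicates (without capture of variables). An $\mathbf{MK}$-frame is a triple $(X,R,E)$ where $X\neq\varnothing$, $R$ is a binary relation on $X$, $E$ is an equivalence relation on $X$, and $x\mathrel{E}y\mathrel{R}z$ implies $x\mathrel{R}u\mathrel{E}z$ for some $u\in X$. Formulae of $\mathcal L_\exists$ are interpreted in it with $R$ for $\Diamond$ and $E$ for $\exists$, and a formula is valid if it is true at every point under every valuation. An $\mathbf{MGrz}$-frame is an $\mathbf{MK}$-frame in which every theorem of $\mathbf{MGrz}$ is valid. Fix an individual variable $x$ and pairwise distinct monadic predicates $p^*$, one for each letter $p$. The translation $(-)^t$ from $\mathcal L_\exists$ to $\mathcal L_Q$ is given by $p^t=p^*(x)$, $(\neg\varphi)^t=\neg\varphi^t$, $(\varphi\vee\psi)^t=\varphi^t\vee\psi^t$, $(\Diamond\varphi)^t=\Diamond\varphi^t$, $(\exists\varphi)^t=\exists x\,\varphi^t$. **Corollary.** 1. $\mathbf{MGrz}$ is complete with respect to $\mathbf{MGrz}$-frames: an $\mathcal L_\exists$-formula is a theorem of $\mathbf{MGrz}$ if and only if it is valid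 in every $\mathbf{MGrz}$-frame. 2. $\mathbf{MGrz}$ is decidable: the set of (Gödel numbers of) theorems of $\mathbf{MGrz}$ is recursive. 3. $\mathbf{MGrz}$ is the monadic (one-variable) fragment of $\mathbf{QGrz}$: for every $\mathcal L_\exists$-formula $\varphi$, $\mathbf{MGrz}\vdash\varphi$ if and only if $\mathbf{QGrz}\vdash\varphi^t$. -/

import Mathlib

universe u

/-! ### Propositional modal formulae and the logic Grz -/

/-- Formulae of the propositional modal language `L`, with primitives `¬`, `∨`, `◇`;
the propositional letters are indexed by `ℕ`. -/
inductive ModalForm : Type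
  | var (p : ℕ) : ModalForm
  | neg (φ : ModalForm) : ModalForm
  | or (φ ψ : ModalForm) : ModalForm
  | dia (φ : ModalForm) : ModalForm

namespace ModalForm

def and (φ ψ : ModalForm) : ModalForm := neg (or (neg φ) (neg ψ))
def imp (φ ψ : ModalForm) : ModalForm := or (neg φ) ψ
def iff (φ ψ : ModalForm) : ModalForm := and (imp φ ψ) (imp ψ φ)
def box (φ : ModalForm) : ModalForm := neg (dia (neg φ))

/-- Classical tautologies: true under every assignment of truth values to formulae that
respects `¬` and `∨` (formulae `◇ φ` are treated as atoms). -/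
def IsTaut (φ : ModalForm) : Prop :=
  ∀ v : ModalForm → Prop, (∀ α, v (neg α) ↔ ¬ v α) → (∀ α β, v (or α β) ↔ (v α ∨ v β)) → v φ

/-- `φ[ψ/p]`. -/
def subst (p : ℕ) (ψ : ModalForm) : ModalForm → ModalForm
  | var q => if q = p then ψ else var q
  | neg φ => neg (subst p ψ φ)
  | or φ χ => or (subst p ψ φ) (subst p ψ χ)
  | dia φ => dia (subst p ψ φ)

end ModalForm

/-- `GrzProv φ` : `φ` is a theorem of the Grzegorczyk logic, the least normal modal logic
containing the S4 axioms and the Grzegorczyk axiom. As `◇` is the primitive, normality includes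
the duality axiom; the Grzegorczyk axiom is in its `◇`-form, the dual of
`□(□(p → □p) → p) → p`. -/
inductive GrzProv : ModalForm → Prop
  | taut {φ : ModalForm} (h : φ.IsTaut) : GrzProv φ
  | axK (φ ψ : ModalForm) : GrzProv (((φ.imp ψ).box).imp (φ.box.imp ψ.box))
  | axDual (φ : ModalForm) : GrzProv (φ.dia.iff φ.neg.box.neg)
  | axT (φ : ModalForm) : GrzProv (φ.imp φ.dia)
  | ax4 (φ : ModalForm) : GrzProv (φ.dia.dia.imp φ.dia)
  | axGrz (φ : ModalForm) :
      GrzProv (φ.imp (φ.and (φ.dia.and φ.neg).dia.neg).dia)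
  | mp {φ ψ : ModalForm} (h₁ : GrzProv φ) (h₂ : GrzProv (φ.imp ψ)) : GrzProv ψ
  | nec {φ : ModalForm} (h : GrzProv φ) : GrzProv φ.box
  | subst {φ : ModalForm} (p : ℕ) (ψ : ModalForm) (h : GrzProv φ) : GrzProv (ModalForm.subst p ψ φ)

/-- The Grzegorczyk logic `Grz`, as a set of formulae. -/
def Grz : Set ModalForm := {φ | GrzProv φ}

/-! ### Monadic modal formulae and least monadic extensions -/

/-- Formulae of the bimodal language `L_∃`, with primitives `¬`, `∨`, `◇`, `∃`. -/
inductive MonForm : Type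
  | var (p : ℕ) : MonForm
  | neg (φ : MonForm) : MonForm
  | or (φ ψ : MonForm) : MonForm
  | dia (φ : MonForm) : MonForm
  | ex (φ : MonForm) : MonForm

namespace MonForm

def and (φ ψ : MonForm) : MonForm := neg (or (neg φ) (neg ψ))
def imp (φ ψ : MonForm) : MonForm := or (neg φ) ψ
def iff (φ ψ : MonForm) : MonForm := and (imp φ ψ) (imp ψ φ)
def box (φ : MonForm) : MonForm := neg (dia (neg φ))
def all (φ : MonForm) : MonForm := neg (ex (neg φ))

/-- Classical tautologies (formulae `◇ φ` and `∃ φ` are treated as atoms). -/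
def IsTaut (φ : MonForm) : Prop :=
  ∀ v : MonForm → Prop, (∀ α, v (neg α) ↔ ¬ v α) → (∀ α β, v (or α β) ↔ (v α ∨ v β)) → v φ

/-- `φ[ψ/p]`. -/
def subst (p : ℕ) (ψ : MonForm) : MonForm → MonForm
  | var q => if q = p then ψ else var q
  | neg φ => neg (subst p ψ φ)
  | or φ χ => or (subst p ψ φ) (subst p ψ χ)
  | dia φ => dia (subst p ψ φ)
  | ex φ => ex (subst p ψ φ)

/-- The inclusion of `L` in `L_∃`. -/
def ofModal : ModalForm → MonForm
  | .var p => var p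
  | .neg φ => neg (ofModal φ)
  | .or φ ψ => or (ofModal φ) (ofModal ψ)
  | .dia φ => dia (ofModal φ)

end MonForm

/-- `MonProv L φ` : `φ` is a theorem of the least monadic extension `ML` of the modal logic `L`.
The constructors `taut` to `exB` are the axioms of S5 for the modality `∃`, in the language
`L_∃`. -/
inductive MonProv (L : Set ModalForm) : MonForm → Prop
  | base {φ : ModalForm} (h : φ ∈ L) : MonProv L (MonForm.ofModal φ)
  | taut {φ : MonForm} (h : φ.IsTaut) : MonProv L φ
  | exK (φ ψ : MonForm) : MonProv L (((φ.imp ψ).all).imp (φ.all.imp ψ.all))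
  | exDual (φ : MonForm) : MonProv L (φ.ex.iff φ.neg.all.neg)
  | exT (φ : MonForm) : MonProv L (φ.imp φ.ex)
  | ex4 (φ : MonForm) : MonProv L (φ.ex.ex.imp φ.ex)
  | exB (φ : MonForm) : MonProv L (φ.imp φ.ex.all)
  | connect (φ : MonForm) : MonProv L (φ.dia.ex.imp φ.ex.dia)
  | mp {φ ψ : MonForm} (h₁ : MonProv L φ) (h₂ : MonProv L (φ.imp ψ)) : MonProv L ψ
  | necBox {φ : MonForm} (h : MonProv L φ) : MonProv L φ.box
  | necAll {φ : MonForm} (h : MonProv L φ) : MonProv L φ.all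
  | subst {φ : MonForm} (p : ℕ) (ψ : MonForm) (h : MonProv L φ) : MonProv L (MonForm.subst p ψ φ)

/-- The monadic Grzegorczyk logic, the least monadic extension of `Grz`. -/
def MGrz : Set MonForm := {φ | MonProv Grz φ}

/-! ### Monadic Kripke frames -/

/-- Monadic Kripke frames. -/
structure MKFrame : Type (u + 1) where
  X : Type u
  nonempty : Nonempty X
  R : X → X → Prop
  E : X → X → Prop
  equiv : Equivalence E
  comm : ∀ x y z, E x y → R y z → ∃ t, R x t ∧ E t z

namespace MKFrame

/-- Truth of a formula at a point, under the valuation `v`. -/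
def Sat (F : MKFrame.{u}) (v : ℕ → Set F.X) : F.X → MonForm → Prop
  | x, .var p => x ∈ v p
  | x, .neg φ => ¬ F.Sat v x φ
  | x, .or φ ψ => F.Sat v x φ ∨ F.Sat v x ψ
  | x, .dia φ => ∃ y, F.R x y ∧ F.Sat v y φ
  | x, .ex φ => ∃ y, F.E x y ∧ F.Sat v y φ

def Valid (F : MKFrame.{u}) (φ : MonForm) : Prop :=
  ∀ (v : ℕ → Set F.X) (x : F.X), F.Sat v x φ

/-- `F` is an `M`-frame: every theorem of `M` is valid in `F`. -/
def IsFrameOf (F : MKFrame.{u}) (M : Set MonForm) : Prop := ∀ φ ∈ M, F.Valid φ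

end MKFrame

/-! ### A Gödel numbering of monadic formulae -/

/-- An explicit Gödel numbering of the formulae of `L_∃`. -/
def MonForm.code : MonForm → ℕ
  | .var p => 5 * p
  | .neg φ => 5 * φ.code + 1
  | .or φ ψ => 5 * Nat.pair φ.code ψ.code + 2
  | .dia φ => 5 * φ.code + 3
  | .ex φ => 5 * φ.code + 4

theorem MonForm.code_injective : Function.Injective MonForm.code := by
  intro φ
  induction φ with
  | var p => intro ψ h; cases ψ <;> simp only [MonForm.code] at h <;> first | omega | skip
             congr 1; omega
  | neg φ ih => intro ψ h; cases ψ <;> simp only [MonForm.code] at h <;> first | omega | skip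
                exact congrArg _ (ih (by omega))
  | or φ χ ih₁ ih₂ =>
    intro ψ h; cases ψ <;> simp only [MonForm.code] at h <;> first | omega | skip
    rename_i α β
    have h' : Nat.pair φ.code χ.code = Nat.pair α.code β.code := by omega
    rw [Nat.pair_eq_pair] at h'
    rw [ih₁ h'.1, ih₂ h'.2]
  | dia φ ih => intro ψ h; cases ψ <;> simp only [MonForm.code] at h <;> first | omega | skip
                exact congrArg _ (ih (by omega))
  | ex φ ih => intro ψ h; cases ψ <;> simp only [MonForm.code] at h <;> first | omega | skip
               exact congrArg _ (ih (by omega))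

theorem MonForm.code_surjective : Function.Surjective MonForm.code := by
  intro n
  induction n using Nat.strong_induction_on with
  | _ n ih =>
    have hn : n = 5 * (n / 5) + n % 5 := by omega
    have hr : n % 5 < 5 := by omega
    generalize n / 5 = q at hn
    generalize n % 5 = r at hn hr
    interval_cases r
    · exact ⟨.var q, by simp only [MonForm.code]; omega⟩
    · obtain ⟨φ, h⟩ := ih q (by omega)
      exact ⟨.neg φ, by simp only [MonForm.code]; omega⟩
    · have h₁ := Nat.unpair_left_le q
      have h₂ := Nat.unpair_right_le q
      obtain ⟨φ, h⟩ := ih (Nat.unpair q).1 (by omega)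
      obtain ⟨ψ, h'⟩ := ih (Nat.unpair q).2 (by omega)
      exact ⟨.or φ ψ, by simp only [MonForm.code, h, h', Nat.pair_unpair]; omega⟩
    · obtain ⟨φ, h⟩ := ih q (by omega)
      exact ⟨.dia φ, by simp only [MonForm.code]; omega⟩
    · obtain ⟨φ, h⟩ := ih q (by omega)
      exact ⟨.ex φ, by simp only [MonForm.code]; omega⟩

/-- Computability on `L_∃`-formulae is computability on their Gödel numbers. -/
noncomputable instance MonForm.primcodable : Primcodable MonForm :=
  Primcodable.ofEquiv ℕ
    (Equiv.ofBijective MonForm.code ⟨MonForm.code_injective, MonForm.code_surjective⟩)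

/-! ### Predicate modal formulae and least predicate extensions -/

/-- Formulae of the predicate modal language `L_Q`. Individual variables are indexed by `ℕ`, and
for each arity `m` the `m`-ary predicates are indexed by `ℕ`; `pred m k y` is `P(y₁, …, yₘ)` for
the `k`-th `m`-ary predicate `P`. -/
inductive QForm : Type
  | pred (m k : ℕ) (y : Fin m → ℕ) : QForm
  | neg (φ : QForm) : QForm
  | or (φ ψ : QForm) : QForm
  | dia (φ : QForm) : QForm
  | ex (x : ℕ) (φ : QForm) : QForm

namespace QForm

def imp (φ ψ : QForm) : QForm := or (neg φ) ψ
def box (φ : QForm) : QForm := neg (dia (neg φ))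
def all (x : ℕ) (φ : QForm) : QForm := neg (ex x (neg φ))

/-- Classical tautologies (predicates and formulae `◇ φ`, `∃ x φ` are treated as atoms). -/
def IsTaut (φ : QForm) : Prop :=
  ∀ v : QForm → Prop, (∀ α, v (neg α) ↔ ¬ v α) → (∀ α β, v (or α β) ↔ (v α ∨ v β)) → v φ

/-- Free variables. -/
def fv : QForm → Set ℕ
  | pred _ _ y => Set.range y
  | neg φ => fv φ
  | or φ ψ => fv φ ∪ fv ψ
  | dia φ => fv φ
  | ex x φ => fv φ \ {x}

/-- Simultaneous replacement of every free occurrence of each variable `z` by `ρ z`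
(bound variables are not renamed; see `FreeFor`). -/
def rename : (ℕ → ℕ) → QForm → QForm
  | ρ, pred m k y => pred m k (ρ ∘ y)
  | ρ, neg φ => neg (rename ρ φ)
  | ρ, or φ ψ => or (rename ρ φ) (rename ρ ψ)
  | ρ, dia φ => dia (rename ρ φ)
  | ρ, ex x φ => ex x (rename (Function.update ρ x x) φ)

/-- The replacement `rename ρ` causes no capture: no variable put in place of a free variable
becomes bound. -/
def FreeFor : (ℕ → ℕ) → QForm → Prop
  | _, pred _ _ _ => True
  | ρ, neg φ => FreeFor ρ φ
  | ρ, or φ ψ => FreeFor ρ φ ∧ FreeFor ρ ψ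
  | ρ, dia φ => FreeFor ρ φ
  | ρ, ex x φ => (∀ z ∈ fv φ, z ≠ x → ρ z ≠ x) ∧ FreeFor (Function.update ρ x x) φ

/-- The replacement `[y/x]` of a single variable. -/
def single (x y : ℕ) : ℕ → ℕ := Function.update id x y

/-- The simultaneous replacement `[y₁, …, yₘ / x₁, …, xₘ]`, for distinct `x₁, …, xₘ`. -/
noncomputable def multi {m : ℕ} (x y : Fin m → ℕ) : ℕ → ℕ := Function.extend x y id

/-- The `k`-th `m`-ary predicate occurs in the formula. -/
def Occurs (m k : ℕ) : QForm → Prop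
  | pred m' k' _ => m' = m ∧ k' = k
  | neg φ => Occurs m k φ
  | or φ ψ => Occurs m k φ ∨ Occurs m k ψ
  | dia φ => Occurs m k φ
  | ex _ φ => Occurs m k φ

/-- `φ[ψ/P(x₁, …, xₘ)]`, where `P` is the `k`-th `m`-ary predicate: every `P(y₁, …, yₘ)` in `φ` is
replaced by `ψ[y₁, …, yₘ / x₁, …, xₘ]` (see `PsubstOK` for the condition on variables). -/
noncomputable def psubst (m k : ℕ) (x : Fin m → ℕ) (ψ : QForm) : QForm → QForm
  | pred m' k' y =>
      if h : m' = m ∧ k' = k then ψ.rename (multi x fun i => y (Fin.cast h.1.symm i))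
      else pred m' k' y
  | neg φ => neg (psubst m k x ψ φ)
  | or φ χ => or (psubst m k x ψ φ) (psubst m k x ψ χ)
  | dia φ => dia (psubst m k x ψ φ)
  | ex z φ => ex z (psubst m k x ψ φ)

/-- The replacement `φ[ψ/P(x₁, …, xₘ)]` causes no capture: each `ψ[y₁, …, yₘ / x₁, …, xₘ]` is
capture-free, and no parameter of `ψ` (a free variable other than `x₁, …, xₘ`) becomes bound by a
quantifier of `φ`. -/
def PsubstOK (m k : ℕ) (x : Fin m → ℕ) (ψ : QForm) : QForm → Prop
  | pred m' k' y =>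
      ∀ h : m' = m ∧ k' = k, FreeFor (multi x fun i => y (Fin.cast h.1.symm i)) ψ
  | neg φ => PsubstOK m k x ψ φ
  | or φ χ => PsubstOK m k x ψ φ ∧ PsubstOK m k x ψ χ
  | dia φ => PsubstOK m k x ψ φ
  | ex z φ => (Occurs m k φ → z ∈ fv ψ → z ∈ Set.range x) ∧ PsubstOK m k x ψ φ

/-- The inclusion of `L` in `L_Q`: the propositional letters are the `0`-ary predicates. -/
def ofModal : ModalForm → QForm
  | .var p => pred 0 p Fin.elim0
  | .neg φ => neg (ofModal φ)
  | .or φ ψ => or (ofModal φ) (ofModal ψ)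
  | .dia φ => dia (ofModal φ)

end QForm

/-- `PredProv L φ` : `φ` is a theorem of the least predicate extension `QL` of the modal logic `L`.
The constructors `taut` to `exElim` are the axioms of the classical predicate calculus.
The substitution rule is stated for capture-free replacements; since formulae that differ in their
bound variables are provably equivalent, this yields the same theorems as a rule that first renames
bound variables. -/
inductive PredProv (L : Set ModalForm) : QForm → Prop
  | taut {φ : QForm} (h : φ.IsTaut) : PredProv L φ
  | allInst (φ : QForm) (x y : ℕ) (h : φ.FreeFor (QForm.single x y)) :
      PredProv L ((φ.all x).imp (φ.rename (QForm.single x y)))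
  | exIntro (φ : QForm) (x y : ℕ) (h : φ.FreeFor (QForm.single x y)) :
      PredProv L ((φ.rename (QForm.single x y)).imp (φ.ex x))
  | allIntro (φ ψ : QForm) (x : ℕ) (h : x ∉ φ.fv) :
      PredProv L (((φ.imp ψ).all x).imp (φ.imp (ψ.all x)))
  | exElim (φ ψ : QForm) (x : ℕ) (h : x ∉ φ.fv) :
      PredProv L (((ψ.imp φ).all x).imp ((ψ.ex x).imp φ))
  | base {φ : ModalForm} (h : φ ∈ L) : PredProv L (QForm.ofModal φ)
  | mp {φ ψ : QForm} (h₁ : PredProv L φ) (h₂ : PredProv L (φ.imp ψ)) : PredProv L ψ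
  | nec {φ : QForm} (h : PredProv L φ) : PredProv L φ.box
  | gen {φ : QForm} (x : ℕ) (h : PredProv L φ) : PredProv L (φ.all x)
  | subst {φ : QForm} (m k : ℕ) (x : Fin m → ℕ) (hx : Function.Injective x) (ψ : QForm)
      (hok : QForm.PsubstOK m k x ψ φ) (h : PredProv L φ) :
      PredProv L (QForm.psubst m k x ψ φ)

/-- The predicate Grzegorczyk logic, the least predicate extension of `Grz`. -/
def QGrz : Set QForm := {φ | PredProv Grz φ}

/-! ### The translation -/

/-- The translation `φ ↦ φ^t` of `L_∃` into `L_Q`, for a fixed individual variable `x`, where the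
monadic predicate `p^*` associated with the letter `p` is the `star p`-th unary predicate. -/
def MonForm.trans (x : ℕ) (star : ℕ → ℕ) : MonForm → QForm
  | .var p => .pred 1 (star p) fun _ => x
  | .neg φ => .neg (φ.trans x star)
  | .or φ ψ => .or (φ.trans x star) (ψ.trans x star)
  | .dia φ => .dia (φ.trans x star)
  | .ex φ => .ex x (φ.trans x star)

/-- `M` is the monadic fragment of `Q`, whatever the variable and the (pairwise distinct) monadic
predicates used in the translation. -/
def IsMonadicFragment (M : Set MonForm) (Q : Set QForm) : Prop :=
  ∀ (x : ℕ) (star : ℕ → ℕ), Function.Injective star →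
    ∀ φ : MonForm, φ ∈ M ↔ φ.trans x star ∈ Q

/-! Everything rests on a bounded finite model property: a nontheorem of `MGrz` fails in a finite
frame whose relation `R` is a partial order, of size bounded in terms of its code
(`exists_finite_countermodel`). In such an order every set has final points, which is the semantic
content of the Grzegorczyk axiom, so these frames are `MGrz`-frames and completeness follows.
Decidability follows as well, because the possible countermodels have codes below an explicit bound
and can be tested primitive recursively.

The finite model is extracted from the canonical model. There `R` is reflexive and transitive, and
truth sets of formulae have final points. Each point is labelled by the formulae of code at most `n`
true at it, and each `E`-class, or cluster, by its set of labels. The new points are the realized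
pairs `(T, t)` of a label set and a label in it, and `E` becomes equality of `T`. Projecting `R`
would create cycles, so a step is kept only if `rho T` drops or, with `T` unchanged, `rk T t` drops.
This lexicographic descent gives antisymmetry. No needed successor is lost: `exists_representative`
realizes each pair by a point whose successors with other labels all have lower rank. Commutation of
`E` and `R` survives because `rho` depends on `T` alone (`ExtStep.comm`).

For the monadic fragment, provability passes to translations by induction on derivations.
Conversely, a finite countermodel becomes a functor frame: worlds are clusters, domains are their
elements, and transitions are all maps moving every element along `R`. Soundness of `QGrz` must
allow substituted formulae with parameters, so the Grzegorczyk property is needed for pairs of a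
world and a family of parameters (`grzRel_paramRel`); it rests on the absence of transitions in both
directions between distinct clusters (`toQFrame_eq_of_hom`). -/

/-! ### Grzegorczyk relations and soundness of `Grz` -/

/-- A set `A` has final points for the relation `R`: every point of `A` sees a point of `A` above
which `A` is never re-entered once it has been left. -/
def HasFinal {W : Type*} (R : W → W → Prop) (A : Set W) : Prop :=
  ∀ x ∈ A, ∃ y, R x y ∧ y ∈ A ∧ ∀ w, R y w → w ∉ A → ∀ t, R w t → t ∉ A

/-- Reflexive transitive relations for which every set has final points. -/
structure GrzRel {W : Type*} (R : W → W → Prop) : Prop where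
  refl : ∀ x, R x x
  trans : ∀ x y z, R x y → R y z → R x z
  final : ∀ A : Set W, HasFinal R A

/-- Above a point of `A`, take a point `y` of `A` with the fewest successors. If `A` were left at
`w` and re-entered at `t`, minimality would give `t` the same successors as `y`, hence a cycle
through `w`, which antisymmetry collapses. -/
theorem GrzRel.of_finite_up {W : Type*} {R : W → W → Prop} (hr : ∀ x, R x x)
    (ht : ∀ x y z, R x y → R y z → R x z) (ha : ∀ x y, R x y → R y x → x = y)
    (hf : ∀ x, {y | R x y}.Finite) : GrzRel R := by
  refine ⟨hr, ht, fun A x hx => ?_⟩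
  have hex : ∃ k, ∃ y, R x y ∧ y ∈ A ∧ {z | R y z}.ncard = k := ⟨_, x, hr x, hx, rfl⟩
  classical
  obtain ⟨y, hxy, hyA, hk⟩ := Nat.find_spec hex
  refine ⟨y, hxy, hyA, fun w hyw hwA t hwt htA => hwA ?_⟩
  have hyt := ht _ _ _ hyw hwt
  have hsub : {z | R t z} ⊆ {z | R y z} := fun z hz => ht _ _ _ hyt hz
  have hle : {z | R y z}.ncard ≤ {z | R t z}.ncard := by
    rw [hk]; exact Nat.find_min' hex ⟨t, ht _ _ _ hxy hyt, htA, rfl⟩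
  have heq := Set.eq_of_subset_of_ncard_le hsub hle (hf y)
  have hty : R t y := by
    have : y ∈ {z | R y z} := hr y
    rwa [← heq] at this
  have := ha w y (ht _ _ _ hwt hty) hyw
  rwa [this]

/-- Truth of a modal formula at a point of a Kripke model. -/
def ModalForm.Sat {W : Type*} (R : W → W → Prop) (v : ℕ → Set W) : W → ModalForm → Prop
  | x, .var p => x ∈ v p
  | x, .neg φ => ¬ φ.Sat R v x
  | x, .or φ ψ => φ.Sat R v x ∨ ψ.Sat R v x
  | x, .dia φ => ∃ y, R x y ∧ φ.Sat R v y

theorem ModalForm.sat_subst {W : Type*} (R : W → W → Prop) (v : ℕ → Set W) (p : ℕ)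
    (ψ φ : ModalForm) (x : W) :
    (ModalForm.subst p ψ φ).Sat R v x ↔
      φ.Sat R (Function.update v p {y | ψ.Sat R v y}) x := by
  induction φ generalizing x with
  | var q =>
    by_cases h : q = p
    · subst h; simp [subst, Sat]
    · simp [subst, Sat, h]
  | neg φ ih => simp [subst, Sat, ih]
  | or φ χ ih₁ ih₂ => simp [subst, Sat, ih₁, ih₂]
  | dia φ ih => simp [subst, Sat, ih]

/-- The conclusion is the truth condition of the Grzegorczyk axiom for a formula with truth set `A`.
-/
theorem HasFinal.grz {W : Type*} {R : W → W → Prop} {A : Set W} (h : HasFinal R A) {x : W}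
    (hx : x ∈ A) : ∃ y, R x y ∧ y ∈ A ∧ ¬ ∃ z, R y z ∧ (∃ t, R z t ∧ t ∈ A) ∧ z ∉ A := by
  obtain ⟨y, hxy, hy, hfin⟩ := h x hx
  exact ⟨y, hxy, hy, fun ⟨z, hyz, ⟨t, hzt, ht⟩, hz⟩ => hfin z hyz hz t hzt ht⟩

theorem GrzProv.sound {W : Type*} {R : W → W → Prop} (hR : GrzRel R) {φ : ModalForm}
    (h : GrzProv φ) : ∀ (v : ℕ → Set W) (x : W), φ.Sat R v x := by
  induction h with
  | taut h => exact fun v x => h _ (fun _ => Iff.rfl) (fun _ _ => Iff.rfl)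
  | axK φ ψ =>
    intro v x
    simp only [ModalForm.imp, ModalForm.box, ModalForm.Sat]
    grind
  | axDual φ =>
    intro v x
    simp only [ModalForm.iff, ModalForm.and, ModalForm.imp, ModalForm.box, ModalForm.Sat]
    grind
  | axT φ =>
    intro v x
    simp only [ModalForm.imp, ModalForm.Sat]
    have := hR.refl x
    grind
  | ax4 φ =>
    intro v x
    simp only [ModalForm.imp, ModalForm.Sat]
    have := hR.trans
    grind
  | axGrz φ =>
    intro v x
    have := fun hx => (hR.final {y | φ.Sat R v y}).grz (x := x) hx
    simp only [ModalForm.imp, ModalForm.and, ModalForm.Sat, Set.mem_ofPred_eq] at this ⊢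
    by_cases hx : φ.Sat R v x
    · obtain ⟨y, hxy, hy, hn⟩ := this hx
      refine Or.inr ⟨y, hxy, ?_⟩
      grind
    · exact Or.inl hx
  | mp _ _ ih₁ ih₂ =>
    intro v x
    exact (ih₂ v x).resolve_left (not_not_intro (ih₁ v x))
  | nec _ ih =>
    intro v x
    rintro ⟨y, -, hy⟩
    exact hy (ih v y)
  | subst p ψ _ ih =>
    intro v x
    rw [ModalForm.sat_subst]
    exact ih _ x

namespace MKFrame

theorem sat_ofModal (F : MKFrame.{u}) (v : ℕ → Set F.X) (φ : ModalForm) (x : F.X) :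
    F.Sat v x (MonForm.ofModal φ) ↔ φ.Sat F.R v x := by
  induction φ generalizing x with
  | var q => rfl
  | neg φ ih => simp [MonForm.ofModal, Sat, ModalForm.Sat, ih]
  | or φ χ ih₁ ih₂ => simp [MonForm.ofModal, Sat, ModalForm.Sat, ih₁, ih₂]
  | dia φ ih => simp [MonForm.ofModal, Sat, ModalForm.Sat, ih]

theorem sat_subst (F : MKFrame.{u}) (v : ℕ → Set F.X) (p : ℕ) (ψ φ : MonForm) (x : F.X) :
    F.Sat v x (MonForm.subst p ψ φ) ↔
      F.Sat (Function.update v p {y | F.Sat v y ψ}) x φ := by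
  induction φ generalizing x with
  | var q =>
    by_cases h : q = p
    · subst h; simp [MonForm.subst, Sat]
    · simp [MonForm.subst, Sat, h]
  | neg φ ih => simp [MonForm.subst, Sat, ih]
  | or φ χ ih₁ ih₂ => simp [MonForm.subst, Sat, ih₁, ih₂]
  | dia φ ih => simp [MonForm.subst, Sat, ih]
  | ex φ ih => simp [MonForm.subst, Sat, ih]

/-- Frames whose accessibility relation is a Grzegorczyk relation are `MGrz`-frames. -/
theorem isFrameOf_MGrz (F : MKFrame.{u}) (hR : GrzRel F.R) : F.IsFrameOf MGrz := by
  intro φ h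
  have he := F.equiv
  induction h with
  | base h => exact fun v x => (F.sat_ofModal v _ x).2 (GrzProv.sound hR h v x)
  | taut h => exact fun v x => h _ (fun _ => Iff.rfl) (fun _ _ => Iff.rfl)
  | exK φ ψ =>
    intro v x
    simp only [MonForm.imp, MonForm.all, Sat]
    grind
  | exDual φ =>
    intro v x
    simp only [MonForm.iff, MonForm.and, MonForm.imp, MonForm.all, Sat]
    grind
  | exT φ =>
    intro v x
    simp only [MonForm.imp, Sat]
    have := he.refl x
    grind
  | ex4 φ =>
    intro v x
    simp only [MonForm.imp, Sat]
    have := @he.trans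
    grind
  | exB φ =>
    intro v x
    simp only [MonForm.imp, MonForm.all, Sat]
    have := @he.symm
    grind
  | connect φ =>
    intro v x
    simp only [MonForm.imp, Sat]
    have := F.comm
    grind
  | mp h₁ h₂ ih₁ ih₂ =>
    intro v x
    exact (ih₂ v x).resolve_left (not_not_intro (ih₁ v x))
  | necBox h ih =>
    intro v x
    rintro ⟨y, -, hy⟩
    exact hy (ih v y)
  | necAll h ih =>
    intro v x
    rintro ⟨y, -, hy⟩
    exact hy (ih v y)
  | subst p ψ h ih =>
    intro v x
    rw [sat_subst]
    exact ih _ x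

end MKFrame

/-! ### The canonical model of `MGrz` -/

namespace MonForm

/-- A letter occurring in `φ` has index at most `φ.code`, so larger indices are fresh. -/
theorem subst_eq_self {p : ℕ} (ψ : MonForm) {φ : MonForm} (h : φ.code < p) :
    subst p ψ φ = φ := by
  induction φ with
  | var q => simp only [code] at h; simp [subst]; omega
  | neg φ ih => simp only [code] at h; simp [subst, ih (by omega)]
  | or φ χ ih₁ ih₂ =>
    simp only [code] at h
    have h₁ := Nat.left_le_pair φ.code χ.code
    have h₂ := Nat.right_le_pair φ.code χ.code
    simp [subst, ih₁ (by omega), ih₂ (by omega)]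
  | dia φ ih => simp only [code] at h; simp [subst, ih (by omega)]
  | ex φ ih => simp only [code] at h; simp [subst, ih (by omega)]

end MonForm

namespace MonProv

open MonForm

theorem boxK (φ ψ : MonForm) :
    MonProv Grz (((φ.imp ψ).box).imp (φ.box.imp ψ.box)) := by
  -- Letters are substituted one at a time. The second letter is fresh for `φ`, so the second
  -- substitution leaves the inserted copies of `φ` unchanged.
  have h := ((MonProv.base (L := Grz) (GrzProv.axK (.var (φ.code + 1)) (.var (φ.code + 2)))).subst
    (φ.code + 1) φ).subst (φ.code + 2) ψ
  simpa [ofModal, MonForm.subst, ModalForm.imp, ModalForm.box, MonForm.imp, MonForm.box,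
    subst_eq_self ψ (show φ.code < φ.code + 2 by omega)] using h

theorem boxDual (φ : MonForm) : MonProv Grz (φ.dia.iff φ.neg.box.neg) :=
  (MonProv.base (L := Grz) (GrzProv.axDual (.var 0))).subst 0 φ

theorem diaT (φ : MonForm) : MonProv Grz (φ.imp φ.dia) :=
  (MonProv.base (L := Grz) (GrzProv.axT (.var 0))).subst 0 φ

theorem dia4 (φ : MonForm) : MonProv Grz (φ.dia.dia.imp φ.dia) :=
  (MonProv.base (L := Grz) (GrzProv.ax4 (.var 0))).subst 0 φ

theorem grz (φ : MonForm) : MonProv Grz (φ.imp (φ.and (φ.dia.and φ.neg).dia.neg).dia) :=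
  (MonProv.base (L := Grz) (GrzProv.axGrz (.var 0))).subst 0 φ

end MonProv

/-- Maximal consistent theories containing `MGrz`, presented by their truth predicates. -/
structure IsWorld (v : MonForm → Prop) : Prop where
  neg : ∀ α, v (.neg α) ↔ ¬ v α
  or : ∀ α β, v (.or α β) ↔ (v α ∨ v β)
  thm : ∀ θ, MonProv Grz θ → v θ

namespace IsWorld

variable {v : MonForm → Prop}

theorem imp (h : IsWorld v) (α β : MonForm) : v (α.imp β) ↔ (v α → v β) := by
  simp only [MonForm.imp, h.or, h.neg]; tauto

theorem and (h : IsWorld v) (α β : MonForm) : v (α.and β) ↔ (v α ∧ v β) := by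
  simp only [MonForm.and, h.or, h.neg]; tauto

theorem mono (h : IsWorld v) {α β : MonForm} (hp : MonProv Grz (α.imp β)) (hα : v α) : v β :=
  (h.imp _ _).1 (h.thm _ hp) hα

end IsWorld

theorem MonForm.foldr_imp {v : MonForm → Prop} (hn : ∀ α, v (neg α) ↔ ¬ v α)
    (ho : ∀ α β, v (or α β) ↔ (v α ∨ v β)) (χ : MonForm) (l : List MonForm) :
    v (l.foldr MonForm.imp χ) ↔ ((∀ γ ∈ l, v γ) → v χ) := by
  induction l with
  | nil => simp
  | cons a l ih => simp [imp, hn, ho, ih]; tauto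

/-- Every consistent theory is contained in a maximal one. -/
theorem exists_isWorld {Δ : Set MonForm} (hthm : ∀ θ, MonProv Grz θ → θ ∈ Δ)
    (hmp : ∀ φ ψ, φ ∈ Δ → φ.imp ψ ∈ Δ → ψ ∈ Δ) {χ : MonForm} (hχ : χ ∉ Δ) :
    ∃ v, IsWorld v ∧ ∀ φ ∈ Δ, v φ := by
  classical
  -- The Boolean valuations form a closed subset of a compact product, so finite satisfiability of
  -- `Δ` suffices.
  let B : Set (MonForm → Bool) := (⋂ α, {v | v (.neg α) = !v α}) ∩
    ⋂ α, ⋂ β, {v | v (.or α β) = (v α || v β)}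
  have hB : IsClosed B := by
    have hc : ∀ α, Continuous fun v : MonForm → Bool => v α := continuous_apply
    refine (isClosed_iInter fun α => isClosed_eq (hc _) ?_).inter
      (isClosed_iInter fun α => isClosed_iInter fun β => isClosed_eq (hc _) ?_)
    · exact (continuous_of_discreteTopology (f := fun b : Bool => !b)).comp (hc α)
    · exact (continuous_of_discreteTopology (f := fun p : Bool × Bool => p.1 || p.2)).comp
        ((hc α).prodMk (hc β))
  have key : (B ∩ ⋂ γ : Δ, {v | v γ.1 = true}).Nonempty := by
    by_contra hne
    obtain ⟨t, ht⟩ := hB.isCompact.elim_finite_subfamily_closed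
      (fun γ : Δ => {v : MonForm → Bool | v γ.1 = true})
      (fun γ => isClosed_eq (continuous_apply _) continuous_const)
      (by rw [Set.not_nonempty_iff_eq_empty] at hne; exact hne)
    -- No Boolean valuation satisfies all of `t`, so the iterated implication from `t` to `χ` is a
    -- tautology vacuously.
    have htaut : ((t.toList.map Subtype.val).foldr MonForm.imp χ).IsTaut := by
      intro v hn ho
      rw [MonForm.foldr_imp hn ho]
      intro hall
      exfalso
      have hmem : (fun α => decide (v α)) ∈ B ∩ ⋂ i ∈ t, {v : MonForm → Bool | v i.1 = true} := by
        refine ⟨⟨?_, ?_⟩, ?_⟩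
        · simp [hn]
        · simp [ho]
        · simp only [Set.mem_iInter]
          intro i hi
          have := hall i.1 (List.mem_map.2 ⟨i, Finset.mem_toList.2 hi, rfl⟩)
          simpa using this
      rw [ht] at hmem
      exact hmem
    have hfold : ∀ l : List Δ, (l.map Subtype.val).foldr MonForm.imp χ ∈ Δ → χ ∈ Δ := by
      intro l
      induction l with
      | nil => exact id
      | cons a l ih => exact fun h => ih (hmp _ _ a.2 h)
    exact hχ (hfold _ (hthm _ (.taut htaut)))
  obtain ⟨v, ⟨hv₁, hv₂⟩, hv₃⟩ := key
  simp only [Set.mem_iInter, Set.mem_ofPred_eq] at hv₁ hv₂ hv₃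
  have hΔ : ∀ φ ∈ Δ, v φ = true := fun φ hφ => hv₃ ⟨φ, hφ⟩
  exact ⟨fun α => v α = true, ⟨fun α => by simp [hv₁], fun α β => by simp [hv₂],
    fun θ hθ => hΔ _ (hthm _ hθ)⟩, hΔ⟩

/-- A unary connective that is the dual of a normal necessity operator of `MGrz`. -/
structure IsNormalOp (d : MonForm → MonForm) : Prop where
  K : ∀ φ ψ : MonForm, MonProv Grz (((d (φ.imp ψ).neg).neg).imp
    ((d φ.neg).neg.imp (d ψ.neg).neg))
  dual : ∀ φ : MonForm, MonProv Grz ((d φ).iff (d φ.neg.neg).neg.neg)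
  nec : ∀ φ : MonForm, MonProv Grz φ → MonProv Grz (d φ.neg).neg

theorem isNormalOp_dia : IsNormalOp .dia :=
  ⟨.boxK, .boxDual, fun _ => .necBox⟩

theorem isNormalOp_ex : IsNormalOp .ex :=
  ⟨.exK, .exDual, fun _ => .necAll⟩

/-! ### Normal operators and the existence lemma -/

namespace IsNormalOp

variable {d : MonForm → MonForm} {v : MonForm → Prop}

theorem apply_iff (hd : IsNormalOp d) (hv : IsWorld v) (φ : MonForm) :
    v (d φ) ↔ v (d φ.neg.neg) := by
  have := hv.thm _ (hd.dual φ)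
  simp only [MonForm.iff, hv.and, hv.imp, hv.neg] at this
  tauto

theorem box_mono (hd : IsNormalOp d) (hv : IsWorld v) {φ ψ : MonForm}
    (hp : MonProv Grz (φ.imp ψ)) (h : ¬ v (d φ.neg)) : ¬ v (d ψ.neg) := by
  have := hv.mono (hd.K φ ψ) (hv.thm _ (hd.nec _ hp))
  simp only [hv.imp, hv.neg] at this
  exact this h

theorem box_mp (hd : IsNormalOp d) (hv : IsWorld v) {φ ψ θ : MonForm}
    (hp : MonProv Grz (φ.imp (ψ.imp θ))) (h₁ : ¬ v (d φ.neg)) (h₂ : ¬ v (d ψ.neg)) :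
    ¬ v (d θ.neg) := by
  have h₃ := hd.box_mono hv hp h₁
  have := hv.thm _ (hd.K ψ θ)
  simp only [hv.imp, hv.neg] at this
  exact this h₃ h₂

theorem mono (hd : IsNormalOp d) (hv : IsWorld v) {φ ψ : MonForm}
    (hp : MonProv Grz (φ.imp ψ)) (h : v (d φ)) : v (d ψ) := by
  by_contra hn
  rw [hd.apply_iff hv] at h hn
  refine hd.box_mono hv ?_ hn h
  exact .mp hp (.taut fun v hn ho => by simp only [MonForm.imp, hn, ho]; tauto)

/-- With `□` the dual of `d`, the set of all `χ` with `□(ψ → χ)` true at `v` is closed under modus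
ponens by K, and it omits `¬(ψ → ψ)` because `d ψ` is true. A world extending it contains `ψ`, and
contains `¬χ` whenever `d χ` fails at `v`. -/
theorem exists_world (hd : IsNormalOp d) (hv : IsWorld v) {ψ : MonForm} (h : v (d ψ)) :
    ∃ w, IsWorld w ∧ w ψ ∧ ∀ χ, w χ → v (d χ) := by
  obtain ⟨w, hw, hΔ⟩ := exists_isWorld (Δ := {χ | ¬ v (d (ψ.imp χ).neg)}) (χ := (ψ.imp ψ).neg)
    (fun θ hθ => by
      have : MonProv Grz (ψ.imp θ) :=
        .mp hθ (.taut fun v hn ho => by simp only [MonForm.imp, hn, ho]; tauto)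
      simpa only [Set.mem_ofPred_eq, hv.neg] using hv.thm _ (hd.nec _ this))
    (fun φ χ h₁ h₂ => hd.box_mp hv
      (.taut fun v hn ho => by simp only [MonForm.imp, hn, ho]; tauto) h₁ h₂)
    (by
      simp only [Set.mem_ofPred_eq, not_not]
      refine hd.mono hv ?_ h
      exact .taut fun v hn ho => by simp only [MonForm.imp, hn, ho]; tauto)
  refine ⟨w, hw, ?_, fun χ hχ => ?_⟩
  · refine hΔ ψ ?_
    have : MonProv Grz (ψ.imp ψ) := .taut fun v hn ho => by simp only [MonForm.imp, hn, ho]; tauto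
    simpa only [Set.mem_ofPred_eq, hv.neg] using hv.thm _ (hd.nec _ this)
  · by_contra hn
    refine (hw.neg χ).1 (hΔ χ.neg ?_) hχ
    rw [hd.apply_iff hv] at hn
    exact hd.box_mono hv (.taut fun v hn ho => by simp only [MonForm.imp, hn, ho]; tauto) hn

end IsNormalOp

/-- The world `u` must contain `∃ψ` for every `ψ` in `z` and every `χ` with `□χ` in `x`. The theory
`Δ` generated by these is consistent: `x` contains `∃◇ψ`, hence `◇∃ψ` by the connecting axiom. -/
theorem IsWorld.connect {x y z : MonForm → Prop} (hx : IsWorld x) (hz : IsWorld z)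
    (hxy : ∀ χ, y χ → x χ.ex) (hyz : ∀ χ, z χ → y χ.dia) :
    ∃ u, IsWorld u ∧ (∀ χ, u χ → x χ.dia) ∧ ∀ χ, z χ → u χ.ex := by
  have hd := isNormalOp_dia
  have he := isNormalOp_ex
  have hmem : ∀ ψ χ : MonForm, z ψ → MonProv Grz (ψ.ex.imp χ) → ¬ x (ψ.ex.imp χ).neg.dia :=
    fun ψ χ _ hp => by simpa only [hx.neg] using hx.thm _ (hd.nec _ hp)
  let t : MonForm := (MonForm.var 0).imp (.var 0)
  have hT : MonProv Grz t := .taut fun v hn ho => by simp only [t, MonForm.imp, hn, ho]; tauto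
  obtain ⟨u, hu, hΔ⟩ := exists_isWorld
    (Δ := {χ | ∃ ψ, z ψ ∧ ¬ x (ψ.ex.imp χ).neg.dia}) (χ := t.neg)
    (fun θ hθ => ⟨t, hz.thm _ hT, hmem _ _ (hz.thm _ hT)
      (.mp hθ (.taut fun v hn ho => by simp only [MonForm.imp, hn, ho]; tauto))⟩)
    (by
      rintro φ χ ⟨ψ₁, h₁, h₁'⟩ ⟨ψ₂, h₂, h₂'⟩
      refine ⟨ψ₁.and ψ₂, (hz.and _ _).2 ⟨h₁, h₂⟩, ?_⟩
      -- Monotonicity of `∃` is known at worlds; a world refuting the implication would contradict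
      -- it, so the implication is a theorem.
      have hA : ∀ ψ : MonForm, MonProv Grz ((ψ₁.and ψ₂).imp ψ) →
          MonProv Grz ((ψ₁.and ψ₂).ex.imp ψ.ex) := by
        intro ψ hψ
        by_contra hn
        obtain ⟨w, hw, hw'⟩ := exists_isWorld
          (Δ := {χ | MonProv Grz (((ψ₁.and ψ₂).ex.imp ψ.ex).neg.imp χ)})
          (χ := (ψ₁.and ψ₂).ex.imp ψ.ex)
          (fun θ hθ => .mp hθ (.taut fun v hn ho => by simp only [MonForm.imp, hn, ho]; tauto))
          (fun φ ψ h₁ h₂ => .mp h₂ (.mp h₁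
            (.taut fun v hn ho => by simp only [MonForm.imp, hn, ho]; tauto)))
          (fun h => hn (.mp h (.taut fun v hn ho => by simp only [MonForm.imp, hn, ho]; tauto)))
        have h₁ := hw' ((ψ₁.and ψ₂).ex.imp ψ.ex).neg
          (.taut fun v hn ho => by simp only [MonForm.imp, hn, ho]; tauto)
        rw [hw.neg, hw.imp] at h₁
        exact h₁ fun h => he.mono hw hψ h
      have h₃ := hA ψ₁ (.taut fun v hn ho => by simp only [MonForm.and, MonForm.imp, hn, ho]; tauto)
      have h₄ := hA ψ₂ (.taut fun v hn ho => by simp only [MonForm.and, MonForm.imp, hn, ho]; tauto)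
      refine hd.box_mp hx (.mp h₃ (.mp h₄ (.taut fun v hn ho => ?_))) h₁' h₂'
      simp only [MonForm.imp, hn, ho]; tauto)
    (by
      rintro ⟨ψ, hψ, h⟩
      have h₁ : x ψ.ex.dia := hx.mono (.connect ψ) (hxy _ (hyz _ hψ))
      refine h (hd.mono hx ?_ h₁)
      refine .mp hT (.taut fun v hn ho => ?_)
      simp only [MonForm.imp, hn, ho]; tauto)
  refine ⟨u, hu, fun χ hχ => ?_, fun χ hχ => ?_⟩
  · by_contra hn
    refine (hu.neg χ).1 (hΔ χ.neg ⟨t, hz.thm _ hT, ?_⟩) hχ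
    rw [hd.apply_iff hx] at hn
    exact hd.box_mono hx (.taut fun v hn ho => by simp only [MonForm.imp, hn, ho]; tauto) hn
  · exact hΔ _ ⟨χ, hχ, hmem _ _ hχ (.taut fun v hn ho => by simp only [MonForm.imp, hn, ho]; tauto)⟩

/-- The canonical frame of `MGrz`; the hypothesis only provides a world. -/
def canonicalFrame (h : ∃ v, IsWorld v) : MKFrame.{0} where
  X := {v // IsWorld v}
  nonempty := ⟨⟨h.choose, h.choose_spec⟩⟩
  R x y := ∀ χ, y.1 χ → x.1 χ.dia
  E x y := ∀ χ, y.1 χ → x.1 χ.ex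
  equiv :=
    { refl := fun x χ h => x.2.mono (.exT χ) h
      symm := fun {x y} h χ hχ => by
        by_contra hn
        have h₁ := h _ ((y.2.neg _).2 hn)
        have h₂ := x.2.mono (.exB χ) hχ
        exact (x.2.neg _).1 h₂ h₁
      trans := fun {x y z} h₁ h₂ χ hχ => x.2.mono (.ex4 χ) (h₁ _ (h₂ _ hχ)) }
  comm x y z hxy hyz := by
    obtain ⟨u, hu, h₁, h₂⟩ := x.2.connect z.2 hxy hyz
    exact ⟨⟨u, hu⟩, h₁, h₂⟩

theorem sat_canonicalFrame (h : ∃ v, IsWorld v) (φ : MonForm) (x : (canonicalFrame h).X) :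
    (canonicalFrame h).Sat (fun p => {y | y.1 (.var p)}) x φ ↔ x.1 φ := by
  induction φ generalizing x with
  | var p => rfl
  | neg φ ih => simp only [MKFrame.Sat, ih, x.2.neg]
  | or φ ψ ih₁ ih₂ => simp only [MKFrame.Sat, ih₁, ih₂, x.2.or]
  | dia φ ih =>
    simp only [MKFrame.Sat, ih]
    refine ⟨fun ⟨y, hxy, hy⟩ => hxy _ hy, fun hx => ?_⟩
    obtain ⟨w, hw, h₁, h₂⟩ := isNormalOp_dia.exists_world x.2 hx
    exact ⟨⟨w, hw⟩, h₂, h₁⟩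
  | ex φ ih =>
    simp only [MKFrame.Sat, ih]
    refine ⟨fun ⟨y, hxy, hy⟩ => hxy _ hy, fun hx => ?_⟩
    obtain ⟨w, hw, h₁, h₂⟩ := isNormalOp_ex.exists_world x.2 hx
    exact ⟨⟨w, hw⟩, h₂, h₁⟩

/-- A nontheorem of `MGrz` fails in a reflexive transitive model in which the truth sets of
formulae have final points. -/
theorem exists_model_of_not_mem_MGrz {φ : MonForm} (hφ : φ ∉ MGrz) :
    ∃ (F : MKFrame.{0}) (v : ℕ → Set F.X) (x : F.X), (∀ x, F.R x x) ∧
      (∀ x y z, F.R x y → F.R y z → F.R x z) ∧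
      (∀ α, HasFinal F.R {x | F.Sat v x α}) ∧ ¬ F.Sat v x φ := by
  obtain ⟨w, hw, hΔ⟩ := exists_isWorld (Δ := {χ | MonProv Grz (φ.neg.imp χ)}) (χ := φ)
    (fun θ hθ => .mp hθ (.taut fun v hn ho => by simp only [MonForm.imp, hn, ho]; tauto))
    (fun φ ψ h₁ h₂ => .mp h₂ (.mp h₁
      (.taut fun v hn ho => by simp only [MonForm.imp, hn, ho]; tauto)))
    (fun h => hφ (.mp h (.taut fun v hn ho => by simp only [MonForm.imp, hn, ho]; tauto)))
  have hex : ∃ v, IsWorld v := ⟨w, hw⟩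
  have htrans : ∀ x y z, (canonicalFrame hex).R x y → (canonicalFrame hex).R y z →
      (canonicalFrame hex).R x z :=
    fun x y z h₁ h₂ χ hχ => x.2.mono (.dia4 χ) (h₁ _ (h₂ _ hχ))
  refine ⟨canonicalFrame hex, fun p => {y | y.1 (.var p)}, ⟨w, hw⟩,
    fun x χ h => x.2.mono (.diaT χ) h, htrans, fun α => ?_, ?_⟩
  · intro x hx
    simp only [Set.mem_ofPred_eq, sat_canonicalFrame] at hx ⊢
    -- The Grzegorczyk axiom provides a successor satisfying `α` and `¬◇(◇α ∧ ¬α)`, that is, a final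
    -- point for `α`.
    obtain ⟨y, hy, h₁, h₂⟩ := isNormalOp_dia.exists_world x.2 (x.2.mono (.grz α) hx)
    rw [hy.and, hy.neg] at h₁
    refine ⟨⟨y, hy⟩, h₂, h₁.1, fun z hyz hz t hzt ht => h₁.2 (hyz _ ?_)⟩
    rw [z.2.and, z.2.neg]
    exact ⟨hzt _ ht, hz⟩
  · refine fun h => (hw.neg φ).1 (hΔ φ.neg ?_) ((sat_canonicalFrame hex φ ⟨w, hw⟩).1 h)
    exact .taut fun v hn ho => by simp only [MonForm.imp, hn, ho]; tauto

/-! ### Finite models -/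

namespace MKFrame

variable {τ : Type} (F : MKFrame.{0}) (ty : F.X → τ)

/-- The labels occurring in the cluster of a point. -/
def cl (x : F.X) : Set τ := {t | ∃ y, F.E x y ∧ ty y = t}

/-- The label sets of the clusters seen from a point. -/
def fut (x : F.X) : Set (Set τ) := {T | ∃ y, F.R x y ∧ F.cl ty y = T}

/-- The labels seen from a point in clusters with the same label set. -/
def loc (x : F.X) : Set τ := {t | ∃ y, F.R x y ∧ F.cl ty y = F.cl ty x ∧ ty y = t}

/-- The least size of the future of a cluster with label set `T`. -/
noncomputable def rho (T : Set τ) : ℕ := sInf {k | ∃ x, F.cl ty x = T ∧ (F.fut ty x).ncard = k}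

/-- The future of the point has the least possible size, and the label set of its cluster does not
reappear after it has been left. -/
def Settled (x : F.X) : Prop :=
  (F.fut ty x).ncard = F.rho ty (F.cl ty x) ∧
    ∀ w, F.R x w → F.cl ty w ≠ F.cl ty x → F.cl ty x ∉ F.fut ty w

/-- The rank of the label `t` in clusters with label set `T`. -/
noncomputable def rk (T : Set τ) (t : τ) : ℕ :=
  sInf {k | ∃ x, F.Settled ty x ∧ F.cl ty x = T ∧ ty x = t ∧ (F.loc ty x).ncard = k}

variable {F ty}

theorem cl_eq {x y : F.X} (h : F.E x y) : F.cl ty x = F.cl ty y := by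
  ext t
  exact ⟨fun ⟨z, hz, ht⟩ => ⟨z, F.equiv.trans (F.equiv.symm h) hz, ht⟩,
    fun ⟨z, hz, ht⟩ => ⟨z, F.equiv.trans h hz, ht⟩⟩

theorem ty_mem_cl (x : F.X) : ty x ∈ F.cl ty x := ⟨x, F.equiv.refl x, rfl⟩

/-- Commutation makes the future an invariant of the cluster. -/
theorem fut_subset_of_E {x y : F.X} (h : F.E x y) : F.fut ty y ⊆ F.fut ty x := by
  rintro T ⟨z, hyz, rfl⟩
  obtain ⟨t, hxt, htz⟩ := F.comm _ _ _ h hyz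
  exact ⟨t, hxt, cl_eq htz⟩

theorem fut_eq {x y : F.X} (h : F.E x y) : F.fut ty x = F.fut ty y :=
  (fut_subset_of_E (F.equiv.symm h)).antisymm (fut_subset_of_E h)

theorem rho_le (x : F.X) : F.rho ty (F.cl ty x) ≤ (F.fut ty x).ncard := Nat.sInf_le ⟨x, rfl, rfl⟩

theorem Settled.of_E {x y : F.X} (hx : F.Settled ty x) (h : F.E x y) : F.Settled ty y := by
  refine ⟨by rw [← fut_eq h, ← cl_eq h, hx.1], fun w hyw hw hn => ?_⟩
  obtain ⟨t, hxt, htw⟩ := F.comm _ _ _ h hyw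
  rw [← cl_eq h] at hw hn
  rw [← cl_eq htw] at hw
  rw [← fut_eq htw] at hn
  exact hx.2 t hxt hw hn

section

variable (hr : ∀ x, F.R x x) (ht : ∀ x y z, F.R x y → F.R y z → F.R x z)
include ht

theorem fut_subset_of_R {x y : F.X} (h : F.R x y) : F.fut ty y ⊆ F.fut ty x := by
  rintro T ⟨z, hyz, rfl⟩
  exact ⟨z, ht _ _ _ h hyz, rfl⟩

theorem loc_subset_of_R {x y : F.X} (h : F.R x y) (hc : F.cl ty y = F.cl ty x) :
    F.loc ty y ⊆ F.loc ty x := by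
  rintro t ⟨z, hyz, hz, rfl⟩
  exact ⟨z, ht _ _ _ h hyz, hz.trans hc, rfl⟩

variable [Finite τ]

theorem Settled.of_R {x y : F.X} (hx : F.Settled ty x) (h : F.R x y)
    (hc : F.cl ty y = F.cl ty x) : F.Settled ty y := by
  refine ⟨le_antisymm ?_ (rho_le y), fun w hyw => ?_⟩
  · rw [hc, ← hx.1]
    exact Set.ncard_le_ncard (fut_subset_of_R ht h) (Set.toFinite _)
  · rw [hc]
    exact hx.2 w (ht _ _ _ h hyw)

/-- Among the points with the given label set, take one with the smallest future, then a final point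
above it. The future can only shrink on the way, so it stays minimal. Moving inside the cluster,
which preserves settledness, recovers the prescribed label. -/
theorem exists_settled (hT : ∀ T, HasFinal F.R {x | F.cl ty x = T}) (x : F.X) :
    ∃ y, F.Settled ty y ∧ F.cl ty y = F.cl ty x ∧ ty y = ty x := by
  obtain ⟨y, hy, hy'⟩ := Nat.sInf_mem
    (s := {k | ∃ y, F.cl ty y = F.cl ty x ∧ (F.fut ty y).ncard = k}) ⟨_, x, rfl, rfl⟩
  obtain ⟨z, hyz, hz, hfin⟩ := hT _ y hy
  have hS : F.Settled ty z := by
    refine ⟨le_antisymm ?_ (rho_le z), fun w hzw hw => ?_⟩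
    · rw [hz, rho, ← hy']
      exact Set.ncard_le_ncard (fut_subset_of_R ht hyz) (Set.toFinite _)
    · rintro ⟨t, hwt, hc⟩
      exact hfin w hzw (fun h => hw (h.trans hz.symm)) t hwt (hc.trans hz)
  have hmem : ty x ∈ F.cl ty z := by rw [hz]; exact ty_mem_cl x
  obtain ⟨w, hzw, hw⟩ := hmem
  exact ⟨w, hS.of_E hzw, (cl_eq hzw).symm.trans hz, hw⟩

include hr

/-- Every pair of a label set and a label in it is represented by a point from which all points
with other labels have pairs of smaller rank. -/
theorem exists_representative (hT : ∀ T, HasFinal F.R {x | F.cl ty x = T})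
    (he : ∀ T t, HasFinal F.R {x | F.cl ty x = T ∧ ty x = t}) (x : F.X) :
    ∃ z, F.cl ty z = F.cl ty x ∧ ty z = ty x ∧ ∀ y, F.R z y → ty y ≠ ty z →
      F.rho ty (F.cl ty y) < F.rho ty (F.cl ty z) ∨
        F.cl ty y = F.cl ty z ∧ F.rk ty (F.cl ty y) (ty y) < F.rk ty (F.cl ty z) (ty z) := by
  obtain ⟨x', hx'⟩ := exists_settled ht hT x
  obtain ⟨y, hyS, hyc, hyt, hy⟩ := Nat.sInf_mem
    (s := {k | ∃ y, F.Settled ty y ∧ F.cl ty y = F.cl ty x ∧ ty y = ty x ∧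
      (F.loc ty y).ncard = k}) ⟨_, x', hx'.1, hx'.2.1, hx'.2.2, rfl⟩
  -- The point `y` attains the rank of the pair; passing to a final point for the pair does not
  -- enlarge `loc`, so `z` attains it too.
  obtain ⟨z, hyz, ⟨hzc, hzt⟩, hfin⟩ := he _ _ y ⟨hyc, hyt⟩
  have hzS := hyS.of_R ht hyz (hzc.trans hyc.symm)
  have hzrk : (F.loc ty z).ncard ≤ F.rk ty (F.cl ty z) (ty z) := by
    rw [hzc, hzt, rk, ← hy]
    exact Set.ncard_le_ncard (loc_subset_of_R ht hyz (hzc.trans hyc.symm)) (Set.toFinite _)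
  refine ⟨z, hzc, hzt, fun w hzw hw => ?_⟩
  by_cases hc : F.cl ty w = F.cl ty z
  -- In the same label set, `loc` loses the label of `z`, since its pair has been left and cannot be
  -- re-entered.
  · refine Or.inr ⟨hc, lt_of_le_of_lt (Nat.sInf_le ⟨w, hzS.of_R ht hzw hc, rfl, rfl, rfl⟩)
      (lt_of_lt_of_le (Set.ncard_lt_ncard ⟨loc_subset_of_R ht hzw hc, fun h => ?_⟩
        (Set.toFinite _)) hzrk)⟩
    obtain ⟨t, hwt, htc, htt⟩ := h ⟨z, hr z, rfl, rfl⟩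
    exact hfin w hzw (fun h => hw (h.2.trans hzt.symm)) t hwt
      ⟨(htc.trans hc).trans hzc, htt.trans hzt⟩
  -- In another label set, the future loses the label set of `z`, since `z` is settled.
  · refine Or.inl (lt_of_le_of_lt (rho_le w) ?_)
    rw [← hzS.1]
    exact Set.ncard_lt_ncard ⟨fut_subset_of_R ht hzw,
      fun h => hzS.2 w hzw hc (h ⟨z, hr z, rfl⟩)⟩ (Set.toFinite _)

end

/-! ### The finite frame of realized pairs -/

variable (F ty)

/-- The pairs of a label set and a label in it that are realized in the frame. -/
def Ext : Type := {e : Set τ × τ // ∃ x, F.cl ty x = e.1 ∧ ty x = e.2}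

instance [Finite τ] : Finite (F.Ext ty) := Subtype.finite

variable {F ty}

/-- One step of the accessibility relation between realized pairs. -/
def ExtStep (e e' : F.Ext ty) : Prop :=
  (∃ x y, F.R x y ∧ (F.cl ty x = e.1.1 ∧ ty x = e.1.2) ∧ F.cl ty y = e'.1.1 ∧ ty y = e'.1.2) ∧
    (F.rho ty e'.1.1 < F.rho ty e.1.1 ∨
      e'.1.1 = e.1.1 ∧ F.rk ty e'.1.1 e'.1.2 < F.rk ty e.1.1 e.1.2)

theorem ExtStep.lex {e e' : F.Ext ty} (h : Relation.ReflTransGen ExtStep e e') :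
    e = e' ∨ F.rho ty e'.1.1 < F.rho ty e.1.1 ∨
      e'.1.1 = e.1.1 ∧ F.rk ty e'.1.1 e'.1.2 < F.rk ty e.1.1 e.1.2 := by
  induction h with
  | refl => exact Or.inl rfl
  | tail _ hs ih =>
    right
    rcases ih with rfl | h | ⟨h, h'⟩
    · exact hs.2
    · rcases hs.2 with h₂ | ⟨h₂, h₂'⟩
      · exact Or.inl (h₂.trans h)
      · exact Or.inl (by rwa [h₂])
    · rcases hs.2 with h₂ | ⟨h₂, h₂'⟩
      · exact Or.inl (by rwa [h] at h₂)
      · exact Or.inr ⟨h₂.trans h, h₂'.trans h'⟩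

/-- If `rho` drops, the cluster of the source contains a point with the label of `e`, and
commutation in `F` moves it to the target cluster; the drop depends only on label sets. If the label
set is unchanged, `e` itself serves. -/
theorem ExtStep.comm {e e₁ e₂ : F.Ext ty} (h : e.1.1 = e₁.1.1) (hs : ExtStep e₁ e₂) :
    ∃ e' : F.Ext ty, Relation.ReflTransGen ExtStep e e' ∧ e'.1.1 = e₂.1.1 := by
  obtain ⟨⟨x, y, hxy, ⟨hx, hx'⟩, hy, hy'⟩, hlt | ⟨heq, hlt⟩⟩ := hs
  · obtain ⟨x₀, hx₀, hx₀'⟩ := e.2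
    have hmem : ty x₀ ∈ F.cl ty x := by rw [hx, ← h, ← hx₀]; exact ty_mem_cl x₀
    obtain ⟨w, hxw, hw⟩ := hmem
    obtain ⟨t, hwt, hty⟩ := F.comm _ _ _ (F.equiv.symm hxw) hxy
    have htc : F.cl ty t = e₂.1.1 := (cl_eq hty).trans hy
    refine ⟨⟨(F.cl ty t, ty t), t, rfl, rfl⟩, .single ⟨⟨w, t, hwt, ⟨?_, ?_⟩, rfl, rfl⟩, ?_⟩, htc⟩
    · rw [← cl_eq hxw, hx, h]
    · rw [hw, hx₀']
    · left
      dsimp only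
      rw [htc, h]
      exact hlt
  · exact ⟨e, .refl, h.trans heq.symm⟩

variable (F ty)

/-- The finite frame of realized pairs. -/
def extFrame : MKFrame.{0} where
  X := F.Ext ty
  nonempty := let ⟨x⟩ := F.nonempty; ⟨⟨(F.cl ty x, ty x), x, rfl, rfl⟩⟩
  R := Relation.ReflTransGen ExtStep
  E e e' := e.1.1 = e'.1.1
  equiv := ⟨fun _ => rfl, fun h => h.symm, fun h h' => h.trans h'⟩
  comm e e₁ e₂ h hs := by
    induction hs with
    | refl => exact ⟨e, .refl, h⟩
    | tail _ hs ih =>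
      obtain ⟨e', he', h'⟩ := ih
      obtain ⟨e'', he'', h''⟩ := ExtStep.comm h' hs
      exact ⟨e'', he'.trans he'', h''⟩

theorem extFrame_antisymm (e e' : F.Ext ty) (h : (F.extFrame ty).R e e')
    (h' : (F.extFrame ty).R e' e) : e = e' := by
  rcases ExtStep.lex h with h₁ | h₁ | ⟨h₁, h₂⟩
  · exact h₁
  · rcases ExtStep.lex h' with h₃ | h₃ | ⟨h₃, h₄⟩
    · exact h₃.symm
    · omega
    · rw [h₃] at h₁; omega
  · rcases ExtStep.lex h' with h₃ | h₃ | ⟨h₃, h₄⟩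
    · exact h₃.symm
    · rw [h₁] at h₃; omega
    · omega

end MKFrame

/-- The formula with a given code. -/
noncomputable def MonForm.decode : ℕ → MonForm :=
  (Equiv.ofBijective MonForm.code ⟨MonForm.code_injective, MonForm.code_surjective⟩).symm

theorem MonForm.decode_code (φ : MonForm) : MonForm.decode φ.code = φ :=
  (Equiv.ofBijective MonForm.code ⟨MonForm.code_injective, MonForm.code_surjective⟩).symm_apply_apply
    φ

/-! ### Definability of labels and the truth lemma for the finite frame -/

namespace MKFrame

variable (F : MKFrame.{0}) (v : ℕ → Set F.X)

/-- The set of the formulae of code at most `n` true at a point. -/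
def theory (n : ℕ) (x : F.X) : Set (Fin (n + 1)) := {i | F.Sat v x (MonForm.decode i)}

/-- The sets defined by formulae. -/
def Definable (A : Set F.X) : Prop := ∃ α, ∀ x, x ∈ A ↔ F.Sat v x α

variable {F v}

theorem Definable.compl {A : Set F.X} (h : F.Definable v A) : F.Definable v Aᶜ := by
  obtain ⟨α, hα⟩ := h
  exact ⟨α.neg, fun x => by simp [Sat, hα]⟩

theorem Definable.inter {A B : Set F.X} (hA : F.Definable v A) (hB : F.Definable v B) :
    F.Definable v (A ∩ B) := by
  obtain ⟨α, hα⟩ := hA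
  obtain ⟨β, hβ⟩ := hB
  exact ⟨α.and β, fun x => by simp [MonForm.and, Sat, hα, hβ]⟩

theorem Definable.univ : F.Definable v Set.univ :=
  ⟨.or (.var 0) (.neg (.var 0)), fun x => by simp [Sat, Classical.em]⟩

theorem Definable.iInter {ι : Type*} [Finite ι] {A : ι → Set F.X}
    (h : ∀ i, F.Definable v (A i)) : F.Definable v (⋂ i, A i) := by
  classical
  have key : ∀ s : Finset ι, F.Definable v (⋂ i ∈ s, A i) := by
    intro s
    induction s using Finset.induction_on with
    | empty => simpa using Definable.univ
    | insert a s ha ih => rw [Finset.set_biInter_insert]; exact (h a).inter ih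
  cases nonempty_fintype ι
  simpa using key Finset.univ

theorem Definable.iff {A : Set F.X} (h : F.Definable v A) (p : Prop) :
    F.Definable v {x | x ∈ A ↔ p} := by
  by_cases hp : p
  · simpa [hp] using h
  · have : {x | x ∈ A ↔ p} = Aᶜ := by ext x; simp [hp]
    rw [this]
    exact h.compl

theorem Definable.theory_eq (n : ℕ) (t : Set (Fin (n + 1))) :
    F.Definable v {x | F.theory v n x = t} := by
  have : {x | F.theory v n x = t} =
      ⋂ i : Fin (n + 1), {x | x ∈ {x | F.Sat v x (MonForm.decode i)} ↔ i ∈ t} := by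
    ext x
    simp [theory, Set.ext_iff]
  rw [this]
  exact .iInter fun i => .iff ⟨_, fun x => Iff.rfl⟩ _

/-- Final points are available only for sets defined by formulae. There are finitely many labels, so
a label set is described by a finite conjunction of formulae `∃α` and their negations, with `α`
defining a label. -/
theorem Definable.cl_theory_eq (n : ℕ) (T : Set (Set (Fin (n + 1)))) :
    F.Definable v {x | F.cl (F.theory v n) x = T} := by
  have : {x | F.cl (F.theory v n) x = T} =
      ⋂ t : Set (Fin (n + 1)), {x | x ∈ {x | ∃ y, F.E x y ∧ F.theory v n y = t} ↔ t ∈ T} := by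
    ext x
    simp [cl, Set.ext_iff]
  rw [this]
  refine .iInter fun t => .iff ?_ _
  obtain ⟨α, hα⟩ := Definable.theory_eq (F := F) (v := v) n t
  exact ⟨α.ex, fun x => by simp only [Sat, ← hα]; rfl⟩

variable (F v)

/-- The valuation of the finite frame given by the labels. -/
def extVal (n : ℕ) : ℕ → Set (F.extFrame (F.theory v n)).X :=
  fun p => {e | ∃ h : 5 * p < n + 1, (⟨5 * p, h⟩ : Fin (n + 1)) ∈ e.1.2}

variable {F v}

/-- Subformulae have smaller codes, so the formulae of code at most `n` are closed under subformulae
and induction applies. -/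
theorem sat_extFrame (hr : ∀ x, F.R x x) (ht : ∀ x y z, F.R x y → F.R y z → F.R x z)
    (hfin : ∀ α, HasFinal F.R {x | F.Sat v x α}) (n : ℕ) (φ : MonForm) (hφ : φ.code < n + 1)
    (e : F.Ext (F.theory v n)) :
    (F.extFrame (F.theory v n)).Sat (F.extVal v n) e φ ↔ (⟨φ.code, hφ⟩ : Fin (n + 1)) ∈ e.1.2 := by
  have hdef : ∀ A, F.Definable v A → HasFinal F.R A := by
    rintro A ⟨α, hα⟩
    have : A = {x | F.Sat v x α} := Set.ext hα
    rw [this]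
    exact hfin α
  have hrep := exists_representative (ty := F.theory v n) hr ht
    (fun T => hdef _ (.cl_theory_eq n T))
    (fun T t => hdef _ ((Definable.cl_theory_eq n T).inter (.theory_eq n t)))
  have hmem : ∀ (ψ : MonForm) (hψ : ψ.code < n + 1) (x : F.X),
      (⟨ψ.code, hψ⟩ : Fin (n + 1)) ∈ F.theory v n x ↔ F.Sat v x ψ := by
    intro ψ hψ x
    simp only [theory, Set.mem_ofPred_eq, MonForm.decode_code]
  induction φ generalizing e with
  | var p => exact ⟨fun ⟨_, h⟩ => h, fun h => ⟨hφ, h⟩⟩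
  | neg φ ih =>
    have hφ' : φ.code < n + 1 := by simp only [MonForm.code] at hφ; omega
    obtain ⟨x, hx, hx'⟩ := e.2
    simp only [Sat, ih hφ', ← hx', hmem]
  | or φ ψ ih₁ ih₂ =>
    have h₁ := Nat.left_le_pair φ.code ψ.code
    have h₂ := Nat.right_le_pair φ.code ψ.code
    have hφ₁ : φ.code < n + 1 := by simp only [MonForm.code] at hφ; omega
    have hφ₂ : ψ.code < n + 1 := by simp only [MonForm.code] at hφ; omega
    obtain ⟨x, hx, hx'⟩ := e.2
    simp only [Sat, ih₁ hφ₁, ih₂ hφ₂, ← hx', hmem]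
  | dia φ ih =>
    have hφ' : φ.code < n + 1 := by simp only [MonForm.code] at hφ; omega
    simp only [Sat]
    constructor
    · rintro ⟨e', he, h⟩
      -- A label containing `φ` contains `◇φ` by reflexivity. Every step comes from an `R`-pair with
      -- the same labels, so transitivity carries `◇φ` back along the path.
      have hT : ∀ e : F.Ext (F.theory v n), (⟨φ.code, hφ'⟩ : Fin (n + 1)) ∈ e.1.2 →
          (⟨φ.dia.code, hφ⟩ : Fin (n + 1)) ∈ e.1.2 := by
        intro e h
        obtain ⟨x, hx, hx'⟩ := e.2
        rw [← hx', hmem] at h ⊢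
        exact ⟨x, hr x, h⟩
      have h' := hT _ ((ih hφ' _).1 h)
      clear h
      induction he with
      | refl => exact h'
      | tail _ hs ih' =>
        obtain ⟨⟨x, y, hxy, ⟨-, hx⟩, -, hy⟩, -⟩ := hs
        refine ih' ?_
        rw [← hy, hmem] at h'
        rw [← hx, hmem]
        obtain ⟨z, hyz, hz⟩ := h'
        exact ⟨z, ht _ _ _ hxy hyz, hz⟩
    · intro h
      -- If `φ` fails at `e`, the successor of the representative `z` satisfying `φ` has a different
      -- label, hence lower rank, and is one step away.
      by_cases hself : (⟨φ.code, hφ'⟩ : Fin (n + 1)) ∈ e.1.2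
      · exact ⟨e, .refl, (ih hφ' _).2 hself⟩
      · obtain ⟨x, hx, hx'⟩ := e.2
        obtain ⟨z, hzc, hzt, hz⟩ := hrep x
        rw [hx] at hzc
        rw [hx'] at hzt
        rw [← hzt, hmem] at h hself
        obtain ⟨y, hzy, hy⟩ := h
        refine ⟨⟨(F.cl _ y, F.theory v n y), y, rfl, rfl⟩,
          .single ⟨⟨z, y, hzy, ⟨hzc, hzt⟩, rfl, rfl⟩, ?_⟩, (ih hφ' _).2 ((hmem _ _ _).2 hy)⟩
        have := hz y hzy (fun h => hself ((hmem _ hφ' _).1 (h ▸ (hmem _ hφ' _).2 hy)))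
        rw [hzc, hzt] at this
        exact this
  | ex φ ih =>
    have hφ' : φ.code < n + 1 := by simp only [MonForm.code] at hφ; omega
    obtain ⟨x, hx, hx'⟩ := e.2
    simp only [Sat, ← hx', hmem]
    constructor
    · rintro ⟨e', he : e.1.1 = e'.1.1, h⟩
      replace h := (ih hφ' _).1 h
      obtain ⟨y, hy, hy'⟩ := e'.2
      have hyx : F.theory v n y ∈ F.cl (F.theory v n) x := by
        rw [hx, he, ← hy]; exact ty_mem_cl y
      obtain ⟨w, hxw, hw⟩ := hyx
      rw [← hy', ← hw, hmem] at h
      exact ⟨w, hxw, h⟩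
    · rintro ⟨y, hxy, hy⟩
      exact ⟨⟨(F.cl _ y, F.theory v n y), y, rfl, rfl⟩, hx.symm.trans (cl_eq hxy),
        (ih hφ' _).2 ((hmem _ _ _).2 hy)⟩

end MKFrame

/-- A bound for the size of a countermodel of a nontheorem with code `n`. -/
def modelBound (n : ℕ) : ℕ := 2 ^ (2 ^ (n + 1)) * 2 ^ (n + 1)

theorem MKFrame.card_ext_le (n : ℕ) (F : MKFrame.{0}) (ty : F.X → Set (Fin (n + 1))) :
    Nat.card (F.Ext ty) ≤ modelBound n := by
  calc Nat.card (F.Ext ty) ≤ Nat.card (Set (Set (Fin (n + 1))) × Set (Fin (n + 1))) :=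
        Nat.card_le_card_of_injective _ Subtype.val_injective
    _ = modelBound n := by
        simp [modelBound, Nat.card_eq_fintype_card, Fintype.card_set]

/-- The finite model property of `MGrz`: a nontheorem fails in a finite partially ordered frame of
bounded size. -/
theorem exists_finite_countermodel {φ : MonForm} (hφ : φ ∉ MGrz) :
    ∃ (F : MKFrame.{0}) (v : ℕ → Set F.X) (x : F.X), Finite F.X ∧
      Nat.card F.X ≤ modelBound φ.code ∧ (∀ x, F.R x x) ∧
      (∀ x y z, F.R x y → F.R y z → F.R x z) ∧ (∀ x y, F.R x y → F.R y x → x = y) ∧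
      ¬ F.Sat v x φ := by
  obtain ⟨F, v, x, hr, ht, hfin, hx⟩ := exists_model_of_not_mem_MGrz hφ
  refine ⟨F.extFrame (F.theory v φ.code), F.extVal v φ.code,
    ⟨(F.cl _ x, F.theory v φ.code x), x, rfl, rfl⟩,
    inferInstanceAs (Finite (F.Ext _)), F.card_ext_le _ _, fun _ => .refl,
    fun _ _ _ h h' => h.trans h', F.extFrame_antisymm _, fun h => hx ?_⟩
  have := (MKFrame.sat_extFrame hr ht hfin φ.code φ (Nat.lt_succ_self _) _).1 h
  simpa only [MKFrame.theory, Set.mem_ofPred_eq, MonForm.decode_code] using this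

/-! ### Decidability of `MGrz` -/

/-- The ternary relation on natural numbers coded by the binary digits of `a`. -/
def bit (a k x y : ℕ) : Prop := a / 2 ^ Nat.pair k (Nat.pair x y) % 2 = 1

/-- Pairing is monotone in both arguments, so all relevant triples index digits below a fixed
length, and `P` can be written digit by digit. -/
theorem exists_bit (P : ℕ → ℕ → ℕ → Prop) (B : ℕ) :
    ∃ a < 2 ^ (Nat.pair 2 (Nat.pair B B) + 1), ∀ k ≤ 2, ∀ x ≤ B, ∀ y ≤ B,
      (bit a k x y ↔ P k x y) := by
  classical
  let f : Fin (Nat.pair 2 (Nat.pair B B) + 1) → Bool := fun i =>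
    decide (P (Nat.unpair i).1 (Nat.unpair (Nat.unpair i).2).1 (Nat.unpair (Nat.unpair i).2).2)
  have hmono : ∀ {i j i' j' : ℕ}, i ≤ i' → j ≤ j' → Nat.pair i j ≤ Nat.pair i' j' := by
    intro i j i' j' hi hj
    calc Nat.pair i j ≤ Nat.pair i' j := by
          rcases hi.lt_or_eq with h | rfl
          · exact (Nat.pair_lt_pair_left _ h).le
          · exact le_rfl
      _ ≤ Nat.pair i' j' := by
          rcases hj.lt_or_eq with h | rfl
          · exact (Nat.pair_lt_pair_right _ h).le
          · exact le_rfl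
  refine ⟨Nat.ofBits f, Nat.ofBits_lt_two_pow f, fun k hk x hx y hy => ?_⟩
  have hlt : Nat.pair k (Nat.pair x y) < Nat.pair 2 (Nat.pair B B) + 1 :=
    Nat.lt_succ_of_le (hmono hk (hmono hx hy))
  have := Nat.testBit_ofBits_lt f _ hlt
  rw [Nat.testBit_eq_decide_div_mod_eq] at this
  simpa [f, bit] using this

/-- `a` codes a partially ordered monadic frame with points `x < m` together with a truth table
for the formulae of code at most `n`, and the formula of code `n` fails at some point. -/
def CodedModel (a m n : ℕ) : Prop :=
  (∀ x < m, bit a 0 x x ∧ bit a 1 x x) ∧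
  (∀ x < m, ∀ y < m, (bit a 0 x y → bit a 0 y x → x = y) ∧ (bit a 1 x y → bit a 1 y x)) ∧
  (∀ x < m, ∀ y < m, ∀ z < m, (bit a 0 x y → bit a 0 y z → bit a 0 x z) ∧
    (bit a 1 x y → bit a 1 y z → bit a 1 x z) ∧
    (bit a 1 x y → bit a 0 y z → ∃ t < m, bit a 0 x t ∧ bit a 1 t z)) ∧
  (∀ c < n + 1, ∀ x < m,
    (c % 5 = 1 → (bit a 2 x c ↔ ¬ bit a 2 x (c / 5))) ∧
    (c % 5 = 2 → (bit a 2 x c ↔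
      (bit a 2 x (Nat.unpair (c / 5)).1 ∨ bit a 2 x (Nat.unpair (c / 5)).2))) ∧
    (c % 5 = 3 → (bit a 2 x c ↔ ∃ y < m, bit a 0 x y ∧ bit a 2 y (c / 5))) ∧
    (c % 5 = 4 → (bit a 2 x c ↔ ∃ y < m, bit a 1 x y ∧ bit a 2 y (c / 5)))) ∧
  ∃ x < m, ¬ bit a 2 x n

/-- The clauses for codes are the recursive truth conditions, so the table is the truth relation of
the valuation that it gives to the letters, whose codes are `5 * p`. -/
theorem CodedModel.not_mem_MGrz {a m : ℕ} {φ : MonForm} (h : CodedModel a m φ.code) :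
    φ ∉ MGrz := by
  obtain ⟨h₁, h₂, h₃, h₄, x, hx, hn⟩ := h
  let F : MKFrame.{0} :=
    { X := Fin m
      nonempty := ⟨⟨x, hx⟩⟩
      R := fun x y => bit a 0 x y
      E := fun x y => bit a 1 x y
      equiv := ⟨fun x => (h₁ x x.2).2, fun {x y} => (h₂ x x.2 y y.2).2,
        fun {x y z} => (h₃ x x.2 y y.2 z z.2).2.1⟩
      comm := fun x y z hxy hyz => by
        obtain ⟨t, ht, ht'⟩ := (h₃ x x.2 y y.2 z z.2).2.2 hxy hyz
        exact ⟨⟨t, ht⟩, ht'⟩ }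
  have hF : GrzRel F.R := GrzRel.of_finite_up (fun x => (h₁ x x.2).1)
    (fun x y z => (h₃ x x.2 y y.2 z z.2).1)
    (fun x y hxy hyx => Fin.ext ((h₂ x x.2 y y.2).1 hxy hyx))
    (fun x => Set.toFinite (α := Fin m) _)
  have key : ∀ ψ : MonForm, ψ.code < φ.code + 1 → ∀ y : Fin m,
      (F.Sat (fun p => {y : Fin m | bit a 2 y (5 * p)}) y ψ ↔ bit a 2 y ψ.code) := by
    intro ψ
    induction ψ with
    | var p => exact fun _ _ => Iff.rfl
    | neg ψ ih =>
      intro hψ y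
      have h := (h₄ _ hψ y y.2).1
      simp only [MonForm.code] at hψ h ⊢
      rw [h (by omega), show (5 * ψ.code + 1) / 5 = ψ.code by omega]
      exact not_congr (ih (by omega) y)
    | or ψ χ ih₁ ih₂ =>
      intro hψ y
      have h := (h₄ _ hψ y y.2).2.1
      have hl := Nat.left_le_pair ψ.code χ.code
      have hr := Nat.right_le_pair ψ.code χ.code
      simp only [MonForm.code] at hψ h ⊢
      rw [h (by omega), show (5 * Nat.pair ψ.code χ.code + 2) / 5 = Nat.pair ψ.code χ.code by omega,
        Nat.unpair_pair]
      exact or_congr (ih₁ (by omega) y) (ih₂ (by omega) y)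
    | dia ψ ih =>
      intro hψ y
      have h := (h₄ _ hψ y y.2).2.2.1
      simp only [MonForm.code] at hψ h ⊢
      rw [h (by omega), show (5 * ψ.code + 3) / 5 = ψ.code by omega]
      exact ⟨fun ⟨z, hyz, hz⟩ => ⟨z.1, z.2, hyz, (ih (by omega) z).1 hz⟩,
        fun ⟨z, hzm, hyz, hz⟩ => ⟨⟨z, hzm⟩, hyz, (ih (by omega) _).2 hz⟩⟩
    | ex ψ ih =>
      intro hψ y
      have h := (h₄ _ hψ y y.2).2.2.2
      simp only [MonForm.code] at hψ h ⊢
      rw [h (by omega), show (5 * ψ.code + 4) / 5 = ψ.code by omega]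
      exact ⟨fun ⟨z, hyz, hz⟩ => ⟨z.1, z.2, hyz, (ih (by omega) z).1 hz⟩,
        fun ⟨z, hzm, hyz, hz⟩ => ⟨⟨z, hzm⟩, hyz, (ih (by omega) _).2 hz⟩⟩
  intro hφ
  exact hn ((key φ (Nat.lt_succ_self _) ⟨x, hx⟩).1 (F.isFrameOf_MGrz hF φ hφ _ _))

theorem MonForm.exists_code_eq (c : ℕ) : ∃ ψ : MonForm, ψ.code = c := MonForm.code_surjective c

/-- A bound for the codes of countermodels of a formula with code `n`. -/
def codeBound (n : ℕ) : ℕ :=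
  2 ^ (Nat.pair 2 (Nat.pair (modelBound n + n) (modelBound n + n)) + 1)

theorem exists_codedModel {φ : MonForm} (hφ : φ ∉ MGrz) :
    ∃ m < modelBound φ.code + 1, ∃ a < codeBound φ.code, CodedModel a m φ.code := by
  obtain ⟨F, v, x₀, hfin, hcard, hr, ht, ha, hx₀⟩ := exists_finite_countermodel hφ
  let e := Finite.equivFin F.X
  set m := Nat.card F.X
  let P : ℕ → ℕ → ℕ → Prop := fun k x y =>
    (k = 0 ∧ ∃ (hx : x < m) (hy : y < m), F.R (e.symm ⟨x, hx⟩) (e.symm ⟨y, hy⟩)) ∨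
    (k = 1 ∧ ∃ (hx : x < m) (hy : y < m), F.E (e.symm ⟨x, hx⟩) (e.symm ⟨y, hy⟩)) ∨
    (k = 2 ∧ ∃ hx : x < m, F.Sat v (e.symm ⟨x, hx⟩) (MonForm.decode y))
  -- The bound is a sum because the digits are indexed both by points and by codes of formulae.
  obtain ⟨a, ha', hbit⟩ := exists_bit P (modelBound φ.code + φ.code)
  have hR : ∀ x y : Fin m, bit a 0 x y ↔ F.R (e.symm x) (e.symm y) := by
    intro x y
    rw [hbit 0 (by omega) x (by omega) y (by omega)]
    simp [P]
  have hE : ∀ x y : Fin m, bit a 1 x y ↔ F.E (e.symm x) (e.symm y) := by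
    intro x y
    rw [hbit 1 (by omega) x (by omega) y (by omega)]
    simp [P]
  have hS : ∀ (x : Fin m) (ψ : MonForm), ψ.code ≤ φ.code →
      (bit a 2 x ψ.code ↔ F.Sat v (e.symm x) ψ) := by
    intro x ψ hψ
    rw [hbit 2 (by omega) x (by omega) _ (by omega)]
    simp [P, MonForm.decode_code]
  refine ⟨m, by omega, a, ha', ?_, ?_, ?_, ?_, ?_⟩
  · intro x hx
    exact ⟨(hR ⟨x, hx⟩ ⟨x, hx⟩).2 (hr _), (hE ⟨x, hx⟩ ⟨x, hx⟩).2 (F.equiv.refl _)⟩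
  · intro x hx y hy
    rw [hR ⟨x, hx⟩ ⟨y, hy⟩, hR ⟨y, hy⟩ ⟨x, hx⟩, hE ⟨x, hx⟩ ⟨y, hy⟩, hE ⟨y, hy⟩ ⟨x, hx⟩]
    refine ⟨fun h h' => ?_, F.equiv.symm⟩
    simpa using ha _ _ h h'
  · intro x hx y hy z hz
    rw [hR ⟨x, hx⟩ ⟨y, hy⟩, hR ⟨y, hy⟩ ⟨z, hz⟩, hR ⟨x, hx⟩ ⟨z, hz⟩, hE ⟨x, hx⟩ ⟨y, hy⟩,
      hE ⟨y, hy⟩ ⟨z, hz⟩, hE ⟨x, hx⟩ ⟨z, hz⟩]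
    refine ⟨ht _ _ _, F.equiv.trans, fun h h' => ?_⟩
    obtain ⟨t, h₁, h₂⟩ := F.comm _ _ _ h h'
    refine ⟨e t, (e t).2, (hR ⟨x, hx⟩ (e t)).2 ?_, (hE (e t) ⟨z, hz⟩).2 ?_⟩
    · simpa using h₁
    · simpa using h₂
  · intro c hc x hx
    have hcase : ∀ (C : ℕ → ℕ → Prop) (S : F.X → F.X → Prop),
        (∀ x y : Fin m, C x y ↔ S (e.symm x) (e.symm y)) → ∀ ψ : MonForm, ψ.code ≤ φ.code →
        ((∃ y < m, C x y ∧ bit a 2 y ψ.code) ↔ ∃ y, S (e.symm ⟨x, hx⟩) y ∧ F.Sat v y ψ) := by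
      intro C S hC ψ hψ
      constructor
      · rintro ⟨y, hy, h₁, h₂⟩
        exact ⟨_, (hC ⟨x, hx⟩ ⟨y, hy⟩).1 h₁, (hS ⟨y, hy⟩ ψ hψ).1 h₂⟩
      · rintro ⟨y, h₁, h₂⟩
        refine ⟨e y, (e y).2, (hC ⟨x, hx⟩ (e y)).2 ?_, (hS (e y) ψ hψ).2 ?_⟩
        · simpa using h₁
        · simpa using h₂
    obtain ⟨ψ, rfl⟩ := MonForm.exists_code_eq c
    rw [hS ⟨x, hx⟩ ψ (by omega)]
    cases ψ with
    | var p => simp only [MonForm.code]; omega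
    | neg ψ =>
      simp only [MonForm.code] at hc ⊢
      rw [show (5 * ψ.code + 1) / 5 = ψ.code by omega, hS ⟨x, hx⟩ ψ (by omega)]
      exact ⟨fun _ => Iff.rfl, by omega, by omega, by omega⟩
    | or ψ χ =>
      have hl := Nat.left_le_pair ψ.code χ.code
      have hr := Nat.right_le_pair ψ.code χ.code
      simp only [MonForm.code] at hc ⊢
      rw [show (5 * Nat.pair ψ.code χ.code + 2) / 5 = Nat.pair ψ.code χ.code by omega,
        Nat.unpair_pair, hS ⟨x, hx⟩ ψ (by omega), hS ⟨x, hx⟩ χ (by omega)]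
      exact ⟨by omega, fun _ => Iff.rfl, by omega, by omega⟩
    | dia ψ =>
      simp only [MonForm.code] at hc ⊢
      rw [show (5 * ψ.code + 3) / 5 = ψ.code by omega, hcase _ _ hR ψ (by omega)]
      exact ⟨by omega, by omega, fun _ => Iff.rfl, by omega⟩
    | ex ψ =>
      simp only [MonForm.code] at hc ⊢
      rw [show (5 * ψ.code + 4) / 5 = ψ.code by omega, hcase _ _ hE ψ (by omega)]
      exact ⟨by omega, by omega, by omega, fun _ => Iff.rfl⟩
  · refine ⟨e x₀, (e x₀).2, fun h => hx₀ ?_⟩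
    simpa using (hS (e x₀) φ le_rfl).1 h

theorem mem_MGrz_iff (φ : MonForm) : φ ∈ MGrz ↔
    ¬ ∃ m < modelBound φ.code + 1, ∃ a < codeBound φ.code, CodedModel a m φ.code :=
  ⟨fun h ⟨_, _, _, _, hM⟩ => hM.not_mem_MGrz h, fun h => by
    by_contra hφ
    exact h (exists_codedModel hφ)⟩

/-! Predicates on environments `l : List ℕ`, the variables being the entries of the list. -/

theorem primrec_env (i : ℕ) : Primrec fun l : List ℕ => l.getD i 0 :=
  (Primrec.list_getD 0).comp Primrec.id (Primrec.const i)

theorem PrimrecPred.imp {α : Type*} [Primcodable α] {p q : α → Prop} (hp : PrimrecPred p)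
    (hq : PrimrecPred q) : PrimrecPred fun a => p a → q a :=
  (hp.not.or hq).of_eq fun _ => imp_iff_not_or.symm

theorem PrimrecPred.iff {α : Type*} [Primcodable α] {p q : α → Prop} (hp : PrimrecPred p)
    (hq : PrimrecPred q) : PrimrecPred fun a => p a ↔ q a :=
  ((hp.imp hq).and (hq.imp hp)).of_eq fun _ => iff_def.symm

/-- Variables are de Bruijn indices: a quantifier pushes its variable onto the head of the list, and
its bound is evaluated in the outer list. -/
theorem PrimrecPred.env_forall_lt {f : List ℕ → ℕ} {p : List ℕ → Prop} (hf : Primrec f)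
    (hp : PrimrecPred p) : PrimrecPred fun l => ∀ x < f l, p (x :: l) := by
  have h : PrimrecRel fun (x : ℕ) (l : List ℕ) => p (x :: l) :=
    hp.comp (Primrec.list_cons.comp Primrec.fst Primrec.snd)
  exact ((h.forall_mem_list).comp (Primrec.list_range.comp hf) Primrec.id).of_eq fun l => by simp

theorem PrimrecPred.env_exists_lt {f : List ℕ → ℕ} {p : List ℕ → Prop} (hf : Primrec f)
    (hp : PrimrecPred p) : PrimrecPred fun l => ∃ x < f l, p (x :: l) := by
  have h : PrimrecRel fun (x : ℕ) (l : List ℕ) => p (x :: l) :=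
    hp.comp (Primrec.list_cons.comp Primrec.fst Primrec.snd)
  exact ((h.exists_mem_list).comp (Primrec.list_range.comp hf) Primrec.id).of_eq fun l => by simp

theorem primrec_two_pow {α : Type*} [Primcodable α] {f : α → ℕ} (hf : Primrec f) :
    Primrec fun a => 2 ^ f a :=
  (Primrec₂.unpaired'.1 Nat.Primrec.pow).comp (Primrec.const 2) hf

theorem primrecPred_bit {α : Type*} [Primcodable α] {a x y : α → ℕ} (ha : Primrec a) (k : ℕ)
    (hx : Primrec x) (hy : Primrec y) : PrimrecPred fun l => bit (a l) k (x l) (y l) :=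
  Primrec.eq.comp (Primrec.nat_mod.comp (Primrec.nat_div.comp ha (primrec_two_pow
    (Primrec₂.natPair.comp (Primrec.const k) (Primrec₂.natPair.comp hx hy)))) (Primrec.const 2))
    (Primrec.const 1)

theorem primrecPred_codedModel :
    PrimrecPred fun l : List ℕ => CodedModel (l.getD 0 0) (l.getD 1 0) (l.getD 2 0) := by
  have v := primrec_env
  have b : ∀ i k j₁ j₂ : ℕ, PrimrecPred fun l : List ℕ =>
      bit (l.getD i 0) k (l.getD j₁ 0) (l.getD j₂ 0) :=
    fun i k j₁ j₂ => primrecPred_bit (v i) k (v j₁) (v j₂)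
  -- Initially `a`, `m`, `n` have indices 0, 1, 2, and each enclosing quantifier raises them by one.
  have h₁ := ((b 1 0 0 0).and (b 1 1 0 0)).env_forall_lt (v 1)
  have h₂ := (((((b 2 0 1 0).imp ((b 2 0 0 1).imp (Primrec.eq.comp (v 1) (v 0)))).and
    ((b 2 1 1 0).imp (b 2 1 0 1))).env_forall_lt (v 2)).env_forall_lt (v 1))
  have h₃ := (((((b 3 0 2 1).imp ((b 3 0 1 0).imp (b 3 0 2 0))).and
    (((b 3 1 2 1).imp ((b 3 1 1 0).imp (b 3 1 2 0))).and
    ((b 3 1 2 1).imp ((b 3 0 1 0).imp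
      (((b 4 0 3 0).and (b 4 1 0 1)).env_exists_lt (v 4)))))).env_forall_lt
    (v 3)).env_forall_lt (v 2)).env_forall_lt (v 1)
  have div : ∀ i, Primrec fun l : List ℕ => l.getD i 0 / 5 :=
    fun i => Primrec.nat_div.comp (v i) (Primrec.const 5)
  have md : ∀ r, PrimrecPred fun l : List ℕ => l.getD 1 0 % 5 = r :=
    fun r => Primrec.eq.comp (Primrec.nat_mod.comp (v 1) (Primrec.const 5)) (Primrec.const r)
  have up : Primrec fun l : List ℕ => Nat.unpair (l.getD 1 0 / 5) := Primrec.unpair.comp (div 1)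
  have h₄ := ((((md 1).imp ((b 2 2 0 1).iff (primrecPred_bit (v 2) 2 (v 0) (div 1)).not)).and
    (((md 2).imp ((b 2 2 0 1).iff
      ((primrecPred_bit (v 2) 2 (v 0) (Primrec.fst.comp up)).or
        (primrecPred_bit (v 2) 2 (v 0) (Primrec.snd.comp up))))).and
    (((md 3).imp ((b 2 2 0 1).iff (((b 3 0 1 0).and
      (primrecPred_bit (v 3) 2 (v 0) (div 2))).env_exists_lt (v 3)))).and
    ((md 4).imp ((b 2 2 0 1).iff (((b 3 1 1 0).and
      (primrecPred_bit (v 3) 2 (v 0) (div 2))).env_exists_lt (v 3))))))).env_forall_lt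
    (v 2)).env_forall_lt (Primrec.succ.comp (v 2))
  have h₅ := ((b 1 2 0 3).not).env_exists_lt (v 1)
  exact h₁.and (h₂.and (h₃.and (h₄.and h₅)))

theorem primrec_modelBound : Primrec modelBound :=
  Primrec.nat_mul.comp (primrec_two_pow (primrec_two_pow Primrec.succ))
    (primrec_two_pow Primrec.succ)

theorem primrec_codeBound : Primrec codeBound := by
  have h : Primrec fun n => modelBound n + n := Primrec.nat_add.comp primrec_modelBound Primrec.id
  exact primrec_two_pow (Primrec.succ.comp (Primrec₂.natPair.comp (Primrec.const 2)
    (Primrec₂.natPair.comp h h)))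

theorem MonForm.primrec_code : Primrec MonForm.code :=
  Primrec.of_equiv (e := Equiv.ofBijective MonForm.code
    ⟨MonForm.code_injective, MonForm.code_surjective⟩)

theorem computablePred_mem_MGrz : ComputablePred fun φ : MonForm => φ ∈ MGrz := by
  have h₁ := primrecPred_codedModel.env_exists_lt (primrec_codeBound.comp (primrec_env 1))
  have h₂ := (h₁.env_exists_lt (Primrec.succ.comp (primrec_modelBound.comp (primrec_env 0)))).not
  have h₃ : PrimrecPred fun φ : MonForm => φ ∈ MGrz :=
    (h₂.comp (Primrec.list_cons.comp MonForm.primrec_code (Primrec.const []))).of_eq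
      fun φ => (mem_MGrz_iff φ).symm
  obtain ⟨hd, h⟩ := h₃
  exact ⟨hd, h.to_comp⟩

/-! ### The translation preserves provability -/

namespace QForm

def and (φ ψ : QForm) : QForm := neg (or (neg φ) (neg ψ))
def iff (φ ψ : QForm) : QForm := and (imp φ ψ) (imp ψ φ)

theorem rename_id (φ : QForm) : φ.rename id = φ := by
  induction φ with
  | pred m k y => rfl
  | neg φ ih => simp [rename, ih]
  | or φ ψ ih₁ ih₂ => simp [rename, ih₁, ih₂]
  | dia φ ih => simp [rename, ih]
  | ex x φ ih =>
    have : Function.update id x x = id := Function.update_eq_self x id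
    simp [rename, this, ih]

theorem freeFor_id (φ : QForm) : φ.FreeFor id := by
  induction φ with
  | pred m k y => trivial
  | neg φ ih => exact ih
  | or φ ψ ih₁ ih₂ => exact ⟨ih₁, ih₂⟩
  | dia φ ih => exact ih
  | ex x φ ih =>
    have : Function.update id x x = id := Function.update_eq_self x id
    exact ⟨fun z _ hz => hz, by rwa [this]⟩

theorem single_self (x : ℕ) : single x x = id := Function.update_eq_self x id

theorem multi_zero (x y : Fin 0 → ℕ) : multi x y = id := by
  funext z
  exact Function.extend_apply' _ _ _ (fun ⟨i, _⟩ => i.elim0)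

theorem psubst_of_not_occurs {m k : ℕ} (x : Fin m → ℕ) (ψ : QForm) {φ : QForm}
    (h : ¬ Occurs m k φ) : psubst m k x ψ φ = φ := by
  induction φ with
  | pred m' k' y => exact dif_neg h
  | neg φ ih => exact congrArg _ (ih h)
  | or φ χ ih₁ ih₂ =>
    rw [psubst, ih₁ fun h' => h (Or.inl h'), ih₂ fun h' => h (Or.inr h')]
  | dia φ ih => exact congrArg _ (ih h)
  | ex z φ ih => exact congrArg _ (ih h)

theorem psubstOK_of_not_occurs {m k : ℕ} (x : Fin m → ℕ) (ψ : QForm) {φ : QForm}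
    (h : ¬ Occurs m k φ) : PsubstOK m k x ψ φ := by
  induction φ with
  | pred m' k' y => exact fun h' => absurd h' h
  | neg φ ih => exact ih h
  | or φ χ ih₁ ih₂ => exact ⟨ih₁ fun h' => h (Or.inl h'), ih₂ fun h' => h (Or.inr h')⟩
  | dia φ ih => exact ih h
  | ex z φ ih => exact ⟨fun h' => absurd h' h, ih h⟩

theorem exists_not_occurs (m : ℕ) (φ : QForm) : ∃ N, ∀ k ≥ N, ¬ Occurs m k φ := by
  induction φ with
  | pred m' k' y => exact ⟨k' + 1, fun k hk h => by have := h.2; omega⟩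
  | neg φ ih => exact ih
  | or φ χ ih₁ ih₂ =>
    obtain ⟨N₁, h₁⟩ := ih₁
    obtain ⟨N₂, h₂⟩ := ih₂
    exact ⟨max N₁ N₂, fun k hk h => h.elim (h₁ k (le_trans (le_max_left _ _) hk))
      (h₂ k (le_trans (le_max_right _ _) hk))⟩
  | dia φ ih => exact ih
  | ex z φ ih => exact ih

end QForm

/-- Simultaneous substitution of predicate formulae for the letters of a modal formula. -/
def ModalForm.inst (τ : ℕ → QForm) : ModalForm → QForm
  | .var p => τ p
  | .neg φ => .neg (φ.inst τ)
  | .or φ ψ => .or (φ.inst τ) (ψ.inst τ)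
  | .dia φ => .dia (φ.inst τ)

theorem ModalForm.inst_subst (τ : ℕ → QForm) (p : ℕ) (ψ φ : ModalForm) :
    (ModalForm.subst p ψ φ).inst τ = φ.inst (Function.update τ p (ψ.inst τ)) := by
  induction φ with
  | var q =>
    by_cases h : q = p
    · subst h; simp [ModalForm.subst, inst]
    · simp [ModalForm.subst, inst, h]
  | neg φ ih => simp [ModalForm.subst, inst, ih]
  | or φ χ ih₁ ih₂ => simp [ModalForm.subst, inst, ih₁, ih₂]
  | dia φ ih => simp [ModalForm.subst, inst, ih]

/-! ### Derived theorems and rules of `QGrz` -/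

namespace PredProv

open QForm

theorem boxK (φ ψ : QForm) :
    PredProv Grz (((φ.imp ψ).box).imp (φ.box.imp ψ.box)) := by
  obtain ⟨N, hN⟩ := exists_not_occurs 0 φ
  have h₁ := PredProv.subst (L := Grz) 0 N Fin.elim0 (fun i => i.elim0) φ
    (by simp [ModalForm.imp, ModalForm.box, ofModal, PsubstOK, multi_zero, freeFor_id])
    (.base (GrzProv.axK (.var N) (.var (N + 1))))
  -- The second letter does not occur in `φ`, so substituting `ψ` for it leaves the inserted copies
  -- of `φ` unchanged and captures nothing there.
  have hφ := hN (N + 1) (by omega)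
  have h₂ := h₁.subst 0 (N + 1) Fin.elim0 (fun i => i.elim0) ψ
    (by simp [ModalForm.imp, ModalForm.box, ofModal, PsubstOK, psubst, multi_zero, freeFor_id,
      rename_id, psubstOK_of_not_occurs _ _ hφ])
  simpa [ModalForm.imp, ModalForm.box, ofModal, psubst, multi_zero, rename_id,
    psubst_of_not_occurs _ _ hφ, QForm.imp, QForm.box] using h₂

/-- Instances of the axioms of `Grz` in one letter. -/
theorem letter_inst {χ : ModalForm} (h : GrzProv χ) (φ : QForm)
    (hok : PsubstOK 0 0 Fin.elim0 φ (ofModal χ)) :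
    PredProv Grz (psubst 0 0 Fin.elim0 φ (ofModal χ)) :=
  .subst 0 0 Fin.elim0 (fun i => i.elim0) φ hok (.base h)

theorem boxDual (φ : QForm) : PredProv Grz (φ.dia.iff φ.neg.box.neg) := by
  have h := letter_inst (.axDual (.var 0)) φ
    (by simp [ModalForm.iff, ModalForm.and, ModalForm.imp, ModalForm.box, ofModal, PsubstOK,
      multi_zero, freeFor_id])
  simpa [ModalForm.iff, ModalForm.and, ModalForm.imp, ModalForm.box, ofModal, psubst, multi_zero,
    rename_id, QForm.iff, QForm.and, QForm.imp, QForm.box] using h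

theorem diaT (φ : QForm) : PredProv Grz (φ.imp φ.dia) := by
  have h := letter_inst (.axT (.var 0)) φ
    (by simp [ModalForm.imp, ofModal, PsubstOK, multi_zero, freeFor_id])
  simpa [ModalForm.imp, ofModal, psubst, multi_zero, rename_id, QForm.imp] using h

theorem dia4 (φ : QForm) : PredProv Grz (φ.dia.dia.imp φ.dia) := by
  have h := letter_inst (.ax4 (.var 0)) φ
    (by simp [ModalForm.imp, ofModal, PsubstOK, multi_zero, freeFor_id])
  simpa [ModalForm.imp, ofModal, psubst, multi_zero, rename_id, QForm.imp] using h

theorem grz (φ : QForm) : PredProv Grz (φ.imp (φ.and (φ.dia.and φ.neg).dia.neg).dia) := by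
  have h := letter_inst (.axGrz (.var 0)) φ
    (by simp [ModalForm.and, ModalForm.imp, ofModal, PsubstOK, multi_zero, freeFor_id])
  simpa [ModalForm.and, ModalForm.imp, ofModal, psubst, multi_zero, rename_id, QForm.and,
    QForm.imp] using h

/-- `QGrz` contains all instances of the theorems of `Grz` in the predicate language. -/
theorem of_grzProv {φ : ModalForm} (h : GrzProv φ) (τ : ℕ → QForm) :
    PredProv Grz (φ.inst τ) := by
  induction h generalizing τ with
  | taut h => exact .taut fun v hn ho => h (fun α => v (α.inst τ)) (fun α => hn _) (fun α β => ho _ _)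
  | axK φ ψ => exact boxK _ _
  | axDual φ => exact boxDual _
  | axT φ => exact diaT _
  | ax4 φ => exact dia4 _
  | axGrz φ => exact grz _
  | mp _ _ ih₁ ih₂ => exact .mp (ih₁ τ) (ih₂ τ)
  | nec _ ih => exact .nec (ih τ)
  | subst p ψ _ ih => rw [ModalForm.inst_subst]; exact ih _

theorem ex_intro (φ : QForm) (x : ℕ) : PredProv Grz (φ.imp (φ.ex x)) := by
  have h := PredProv.exIntro (L := Grz) φ x x (by rw [single_self]; exact freeFor_id φ)
  rwa [single_self, rename_id] at h

theorem all_inst (φ : QForm) (x : ℕ) : PredProv Grz ((φ.all x).imp φ) := by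
  have h := PredProv.allInst (L := Grz) φ x x (by rw [single_self]; exact freeFor_id φ)
  rwa [single_self, rename_id] at h

theorem not_mem_fv_ex (φ : QForm) (x : ℕ) : x ∉ (φ.ex x).fv := fun h => h.2 rfl

theorem ex_elim {φ ψ : QForm} {x : ℕ} (h : x ∉ φ.fv) (hp : PredProv Grz (ψ.imp φ)) :
    PredProv Grz ((ψ.ex x).imp φ) :=
  .mp (.gen x hp) (.exElim φ ψ x h)

theorem all_intro {φ ψ : QForm} {x : ℕ} (h : x ∉ φ.fv) (hp : PredProv Grz (φ.imp ψ)) :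
    PredProv Grz (φ.imp (ψ.all x)) :=
  .mp (.gen x hp) (.allIntro φ ψ x h)

theorem imp_trans {φ ψ χ : QForm} (h₁ : PredProv Grz (φ.imp ψ)) (h₂ : PredProv Grz (ψ.imp χ)) :
    PredProv Grz (φ.imp χ) :=
  .mp h₂ (.mp h₁ (.taut fun v hn ho => by simp only [QForm.imp, hn, ho]; tauto))

theorem ex_mono {φ ψ : QForm} (x : ℕ) (h : PredProv Grz (φ.imp ψ)) :
    PredProv Grz ((φ.ex x).imp (ψ.ex x)) :=
  ex_elim (not_mem_fv_ex ψ x) (imp_trans h (ex_intro ψ x))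

theorem dia_mono {φ ψ : QForm} (h : PredProv Grz (φ.imp ψ)) :
    PredProv Grz (φ.dia.imp ψ.dia) := by
  have h₁ : PredProv Grz (ψ.neg.imp φ.neg) :=
    .mp h (.taut fun v hn ho => by simp only [QForm.imp, hn, ho]; tauto)
  have h₂ := PredProv.mp (.nec h₁) (boxK ψ.neg φ.neg)
  refine .mp h₂ (.mp (boxDual φ) (.mp (boxDual ψ) (.taut fun v hn ho => ?_)))
  simp only [QForm.imp, QForm.iff, QForm.and, hn, ho]
  tauto

theorem exDual (φ : QForm) (x : ℕ) : PredProv Grz ((φ.ex x).iff (φ.neg.all x).neg) := by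
  have h₁ : PredProv Grz ((φ.ex x).imp (φ.neg.neg.ex x)) :=
    ex_mono x (.taut fun v hn ho => by simp only [QForm.imp, hn, ho]; tauto)
  have h₂ : PredProv Grz ((φ.neg.neg.ex x).imp (φ.ex x)) :=
    ex_mono x (.taut fun v hn ho => by simp only [QForm.imp, hn, ho]; tauto)
  refine .mp h₁ (.mp h₂ (.taut fun v hn ho => ?_))
  simp only [QForm.imp, QForm.iff, QForm.and, QForm.all, hn, ho]
  tauto

theorem allK (φ ψ : QForm) (x : ℕ) :
    PredProv Grz (((φ.imp ψ).all x).imp ((φ.all x).imp (ψ.all x))) := by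
  have h : PredProv Grz ((((φ.imp ψ).all x).and (φ.all x)).imp ψ) :=
    .mp (all_inst (φ.imp ψ) x) (.mp (all_inst φ x) (.taut fun v hn ho => by
      simp only [QForm.imp, QForm.and, hn, ho]; tauto))
  have h' := all_intro (x := x) (by simp [QForm.and, QForm.all, fv]) h
  exact .mp h' (.taut fun v hn ho => by simp only [QForm.imp, QForm.and, hn, ho]; tauto)

end PredProv

/-- The translation of a monadic formula, with the letters translated by `θ`. -/
def MonForm.inst (x : ℕ) (θ : ℕ → QForm) : MonForm → QForm
  | .var p => θ p
  | .neg φ => .neg (φ.inst x θ)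
  | .or φ ψ => .or (φ.inst x θ) (ψ.inst x θ)
  | .dia φ => .dia (φ.inst x θ)
  | .ex φ => .ex x (φ.inst x θ)

namespace MonForm

theorem inst_subst (x : ℕ) (θ : ℕ → QForm) (p : ℕ) (ψ φ : MonForm) :
    (subst p ψ φ).inst x θ = φ.inst x (Function.update θ p (ψ.inst x θ)) := by
  induction φ with
  | var q =>
    by_cases h : q = p
    · subst h; simp [subst, inst]
    · simp [subst, inst, h]
  | neg φ ih => simp [subst, inst, ih]
  | or φ χ ih₁ ih₂ => simp [subst, inst, ih₁, ih₂]
  | dia φ ih => simp [subst, inst, ih]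
  | ex φ ih => simp [subst, inst, ih]

theorem inst_ofModal (x : ℕ) (θ : ℕ → QForm) (φ : ModalForm) :
    (ofModal φ).inst x θ = φ.inst θ := by
  induction φ with
  | var q => rfl
  | neg φ ih => simp [ofModal, inst, ModalForm.inst, ih]
  | or φ χ ih₁ ih₂ => simp [ofModal, inst, ModalForm.inst, ih₁, ih₂]
  | dia φ ih => simp [ofModal, inst, ModalForm.inst, ih]

theorem trans_eq_inst (x : ℕ) (star : ℕ → ℕ) (φ : MonForm) :
    φ.trans x star = φ.inst x fun p => .pred 1 (star p) fun _ => x := by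
  induction φ with
  | var q => rfl
  | neg φ ih => simp [trans, inst, ih]
  | or φ χ ih₁ ih₂ => simp [trans, inst, ih₁, ih₂]
  | dia φ ih => simp [trans, inst, ih]
  | ex φ ih => simp [trans, inst, ih]

end MonForm

/-- Letters are sent to arbitrary formulae so that the induction passes through the substitution
rule. The connecting axiom becomes `∃x ◇φ → ◇ ∃x φ`, which follows from `φ → ∃x φ` under `◇`, as `x`
is not free in the conclusion. -/
theorem MonProv.predProv_inst {φ : MonForm} (h : MonProv Grz φ) (x : ℕ) (θ : ℕ → QForm) :
    PredProv Grz (φ.inst x θ) := by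
  induction h generalizing θ with
  | base h => rw [MonForm.inst_ofModal]; exact PredProv.of_grzProv h θ
  | taut h =>
    exact .taut fun v hn ho => h (fun α => v (α.inst x θ)) (fun α => hn _) (fun α β => ho _ _)
  | exK φ ψ => exact PredProv.allK _ _ x
  | exDual φ => exact PredProv.exDual _ x
  | exT φ => exact PredProv.ex_intro _ x
  | ex4 φ =>
    exact PredProv.ex_elim (PredProv.not_mem_fv_ex _ x)
      (.taut fun v hn ho => by simp only [QForm.imp, hn, ho]; tauto)
  | exB φ =>
    exact PredProv.imp_trans (PredProv.ex_intro _ x)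
      (PredProv.all_intro (PredProv.not_mem_fv_ex _ x)
        (.taut fun v hn ho => by simp only [QForm.imp, hn, ho]; tauto))
  | connect φ =>
    exact PredProv.ex_elim (PredProv.not_mem_fv_ex _ x)
      (PredProv.dia_mono (PredProv.ex_intro _ x))
  | mp _ _ ih₁ ih₂ => exact .mp (ih₁ θ) (ih₂ θ)
  | necBox _ ih => exact .nec (ih θ)
  | necAll _ ih => exact .gen x (ih θ)
  | subst p ψ _ ih => rw [MonForm.inst_subst]; exact ih _

/-! ### Functor semantics for the predicate language -/

/-- A frame of possible worlds with domains and a set of transition maps between the domains. -/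
structure QFrame where
  W : Type
  D : W → Type
  Hom : ∀ w w', Set (D w → D w')

namespace QFrame

/-- Interpretations of the predicates, depending on a family of parameters indexed by `ι`. -/
def Interp (F : QFrame) (ι : Type) : Type :=
  ∀ (m _k : ℕ) (w : F.W), (ι → F.D w) → (Fin m → F.D w) → Prop

variable {F : QFrame}

/-- Truth of a formula in a world, for the parameters `a` and the assignment `s`. -/
def Sat {ι : Type} (I : F.Interp ι) : (w : F.W) → (ι → F.D w) → (ℕ → F.D w) → QForm → Prop
  | w, a, s, .pred m k y => I m k w a (s ∘ y)
  | w, a, s, .neg φ => ¬ Sat I w a s φ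
  | w, a, s, .or φ ψ => Sat I w a s φ ∨ Sat I w a s ψ
  | w, a, s, .dia φ => ∃ w', ∃ f ∈ F.Hom w w', Sat I w' (f ∘ a) (f ∘ s) φ
  | w, a, s, .ex x φ => ∃ d : F.D w, Sat I w a (Function.update s x d) φ

variable {ι : Type} (I : F.Interp ι)

theorem sat_congr (φ : QForm) {w : F.W} (a : ι → F.D w) {s s' : ℕ → F.D w}
    (h : ∀ z ∈ φ.fv, s z = s' z) : Sat I w a s φ ↔ Sat I w a s' φ := by
  induction φ generalizing w with
  | pred m k y =>
    have : s ∘ y = s' ∘ y := funext fun i => h _ ⟨i, rfl⟩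
    simp only [Sat, this]
  | neg φ ih => simp only [Sat, ih a h]
  | or φ ψ ih₁ ih₂ =>
    simp only [Sat, ih₁ a fun z hz => h z (Or.inl hz), ih₂ a fun z hz => h z (Or.inr hz)]
  | dia φ ih =>
    simp only [Sat]
    refine exists_congr fun w' => exists_congr fun f => and_congr_right fun _ => ?_
    exact ih _ fun z hz => congrArg f (h z hz)
  | ex x φ ih =>
    simp only [Sat]
    refine exists_congr fun d => ih a fun z hz => ?_
    by_cases hzx : z = x
    · subst hzx; simp
    · simp only [Function.update_of_ne hzx]
      exact h z ⟨hz, hzx⟩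

theorem sat_rename (φ : QForm) {ρ : ℕ → ℕ} (hρ : φ.FreeFor ρ) {w : F.W} (a : ι → F.D w)
    (s : ℕ → F.D w) : Sat I w a s (φ.rename ρ) ↔ Sat I w a (s ∘ ρ) φ := by
  induction φ generalizing w ρ with
  | pred m k y => rfl
  | neg φ ih => simp only [QForm.rename, Sat, ih hρ]
  | or φ ψ ih₁ ih₂ => simp only [QForm.rename, Sat, ih₁ hρ.1, ih₂ hρ.2]
  | dia φ ih =>
    simp only [QForm.rename, Sat]
    refine exists_congr fun w' => exists_congr fun f => and_congr_right fun _ => ?_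
    exact ih hρ _ _
  | ex x φ ih =>
    simp only [QForm.rename, Sat]
    refine exists_congr fun d => ?_
    rw [ih hρ.2]
    refine sat_congr I φ a fun z hz => ?_
    by_cases hzx : z = x
    · subst hzx; simp
    · simp only [Function.comp, Function.update_of_ne hzx,
        Function.update_of_ne (hρ.1 z hz hzx)]

theorem comp_single {α : Type*} (s : ℕ → α) (x y : ℕ) :
    s ∘ QForm.single x y = Function.update s x (s y) := by
  funext z
  by_cases h : z = x
  · subst h; simp [QForm.single]
  · simp [QForm.single, h]

/-- The relation between worlds with parameters induced by the transition maps. -/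
def ParamRel (F : QFrame) (ι : Type) (p q : Σ w, ι → F.D w) : Prop :=
  ∃ f ∈ F.Hom p.1 q.1, f ∘ p.2 = q.2

/-- Letters are `0`-ary, so their truth depends only on the world and the parameters; the formula is
evaluated in the Kripke frame of such pairs. -/
theorem sat_ofModal (φ : ModalForm) {w : F.W} (a : ι → F.D w) (s : ℕ → F.D w) :
    Sat I w a s (QForm.ofModal φ) ↔
      φ.Sat (F.ParamRel ι) (fun p => {q | I 0 p q.1 q.2 fun i => i.elim0}) ⟨w, a⟩ := by
  induction φ generalizing w with
  | var p =>
    have : s ∘ (Fin.elim0 : Fin 0 → ℕ) = fun i => i.elim0 := Subsingleton.elim _ _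
    simp only [QForm.ofModal, Sat, this]
    rfl
  | neg φ ih => simp only [QForm.ofModal, Sat, ModalForm.Sat, ih]
  | or φ ψ ih₁ ih₂ => simp only [QForm.ofModal, Sat, ModalForm.Sat, ih₁, ih₂]
  | dia φ ih =>
    simp only [QForm.ofModal, Sat, ModalForm.Sat]
    constructor
    · rintro ⟨w', f, hf, h⟩
      exact ⟨⟨w', f ∘ a⟩, ⟨f, hf, rfl⟩, (ih _ _).1 h⟩
    · rintro ⟨⟨w', b⟩, ⟨f, hf, hb⟩, h⟩
      dsimp only at f hf hb
      subst hb
      exact ⟨w', f, hf, (ih _ _).2 h⟩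

/-- The interpretation in which the `k`-th `m`-ary predicate is interpreted by the formula `ψ` of
the variables `x`, the other variables of `ψ` being taken as additional parameters. -/
def substInterp (m k : ℕ) (x : Fin m → ℕ) (ψ : QForm) : F.Interp (ι ⊕ ℕ) := fun m' k' w a d =>
  (∃ h : m' = m ∧ k' = k, Sat I w (a ∘ Sum.inl)
    (Function.extend x (fun i => d (Fin.cast h.1.symm i)) (a ∘ Sum.inr)) ψ) ∨
  (¬ (m' = m ∧ k' = k) ∧ I m' k' w (a ∘ Sum.inl) d)

/-- The new parameters hold the values of the free variables of `ψ` other than `x₁, …, xₘ`.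
Agreement with the assignment, `hs`, persists under `◇` because one map transports both, and under
`∃` because substitution captures no such variable. -/
theorem sat_psubst {m k : ℕ} {x : Fin m → ℕ} (hx : Function.Injective x) (ψ φ : QForm)
    (hok : QForm.PsubstOK m k x ψ φ) {w : F.W} (a : ι ⊕ ℕ → F.D w) (s : ℕ → F.D w)
    (hs : QForm.Occurs m k φ → ∀ z ∈ ψ.fv, z ∉ Set.range x → a (Sum.inr z) = s z) :
    Sat I w (a ∘ Sum.inl) s (QForm.psubst m k x ψ φ) ↔ Sat (substInterp I m k x ψ) w a s φ := by
  induction φ generalizing w with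
  | pred m' k' y =>
    by_cases h : m' = m ∧ k' = k
    · have key : Sat I w (a ∘ Sum.inl) s
          (ψ.rename (QForm.multi x fun i => y (Fin.cast h.1.symm i))) ↔
          Sat I w (a ∘ Sum.inl) (Function.extend x (fun i => (s ∘ y) (Fin.cast h.1.symm i))
            (a ∘ Sum.inr)) ψ := by
        rw [sat_rename I ψ (hok h)]
        refine sat_congr I ψ _ fun z hz => ?_
        by_cases hzx : z ∈ Set.range x
        · obtain ⟨i, rfl⟩ := hzx
          simp [QForm.multi, hx.extend_apply]
        · have hzx' : ¬ ∃ i, x i = z := hzx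
          simp only [Function.comp, QForm.multi, Function.extend_apply' _ _ _ hzx', id]
          exact (hs h z hz hzx).symm
      simp only [QForm.psubst, dif_pos h]
      rw [key]
      constructor
      · exact fun h' => Or.inl ⟨h, h'⟩
      · rintro (⟨_, h'⟩ | ⟨h', _⟩)
        · exact h'
        · exact absurd h h'
    · simp only [QForm.psubst, dif_neg h]
      constructor
      · exact fun h' => Or.inr ⟨h, h'⟩
      · rintro (⟨h', _⟩ | ⟨_, h'⟩)
        · exact absurd h' h
        · exact h'
  | neg φ ih => simp only [QForm.psubst, Sat, ih hok a s hs]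
  | or φ χ ih₁ ih₂ =>
    simp only [QForm.psubst, Sat, ih₁ hok.1 a s fun h => hs (Or.inl h),
      ih₂ hok.2 a s fun h => hs (Or.inr h)]
  | dia φ ih =>
    simp only [QForm.psubst, Sat]
    refine exists_congr fun w' => exists_congr fun f => and_congr_right fun _ => ?_
    exact ih hok (f ∘ a) (f ∘ s) fun h z hz hzx => congrArg f (hs h z hz hzx)
  | ex z φ ih =>
    simp only [QForm.psubst, Sat]
    refine exists_congr fun d => ih hok.2 a _ fun h t ht htx => ?_
    have : t ≠ z := by
      rintro rfl
      exact htx (hok.1 h ht)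
    rw [Function.update_of_ne this]
    exact hs h t ht htx

/-- `QGrz` is sound for the frames in which all parametrized accessibility relations are
Grzegorczyk relations. -/
theorem sound (hF : ∀ ι, GrzRel (F.ParamRel ι)) {φ : QForm} (h : PredProv Grz φ) (ι : Type)
    (I : F.Interp ι) (w : F.W) (a : ι → F.D w) (s : ℕ → F.D w) : Sat I w a s φ := by
  induction h generalizing ι w with
  | taut h => exact h _ (fun _ => Iff.rfl) (fun _ _ => Iff.rfl)
  | allInst φ x y h =>
    simp only [QForm.imp, QForm.all, Sat, sat_rename I φ h, comp_single]
    grind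
  | exIntro φ x y h =>
    simp only [QForm.imp, Sat, sat_rename I φ h, comp_single]
    grind
  | allIntro φ ψ x h =>
    have := fun d => sat_congr I φ a (s := Function.update s x d) (s' := s) fun z hz =>
      Function.update_of_ne (by rintro rfl; exact h hz) _ _
    simp only [QForm.imp, QForm.all, Sat, this]
    grind
  | exElim φ ψ x h =>
    have := fun d => sat_congr I φ a (s := Function.update s x d) (s' := s) fun z hz =>
      Function.update_of_ne (by rintro rfl; exact h hz) _ _
    simp only [QForm.imp, QForm.all, Sat, this]
    grind
  | base h =>
    rw [sat_ofModal]
    exact GrzProv.sound (hF ι) h _ _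
  | mp _ _ ih₁ ih₂ => exact (ih₂ ι I w a s).resolve_left (not_not_intro (ih₁ ι I w a s))
  | nec _ ih =>
    rintro ⟨w', f, -, h⟩
    exact h (ih ι I w' _ _)
  | gen x _ ih =>
    rintro ⟨d, h⟩
    exact h (ih ι I w a _)
  | subst m k x hx ψ hok _ ih =>
    -- The current assignment itself supplies the additional parameters.
    exact (sat_psubst I hx ψ _ hok (Sum.elim a s) s fun _ _ _ _ => rfl).2 (ih _ _ w _ _)

end QFrame

/-! ### The functor frame of a monadic frame -/

namespace MKFrame

/-- The frame whose worlds are the clusters of a monadic frame. -/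
def toQFrame (F : MKFrame.{0}) : QFrame where
  W := Quotient ⟨F.E, F.equiv⟩
  D w := {x : F.X // Quotient.mk ⟨F.E, F.equiv⟩ x = w}
  Hom _ _ := {f | ∀ x, F.R x.1 (f x).1}

variable (F : MKFrame.{0}) (hr : ∀ x, F.R x x) (ht : ∀ x y z, F.R x y → F.R y z → F.R x z)
  (ha : ∀ x y, F.R x y → F.R y x → x = y)

include hr ht ha

/-- A point final for the cluster `w` cannot leave `w` along `f` and return along `g`. -/
theorem toQFrame_eq_of_hom [Finite F.X] {w w' : F.toQFrame.W}
    {f : F.toQFrame.D w → F.toQFrame.D w'} (hf : f ∈ F.toQFrame.Hom w w')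
    {g : F.toQFrame.D w' → F.toQFrame.D w} (hg : g ∈ F.toQFrame.Hom w' w) : w = w' := by
  obtain ⟨x₀, hx₀⟩ := Quotient.exists_rep w
  obtain ⟨y, -, hy, hfin⟩ := (GrzRel.of_finite_up hr ht ha fun x => Set.toFinite _).final
    {x : F.X | Quotient.mk ⟨F.E, F.equiv⟩ x = w} x₀ hx₀
  let x : F.toQFrame.D w := ⟨y, hy⟩
  by_contra hne
  refine hfin (f x).1 (hf x) (fun h => hne (h.symm.trans (f x).2)) (g (f x)).1 (hg (f x)) ?_
  exact (g (f x)).2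

/-- Even for infinite `ι`, a family of parameters has finitely many successors, since a successor is
determined by a map between finite domains. For antisymmetry, mutually accessible pairs lie over one
cluster, and their parameters agree by antisymmetry of `R`. -/
theorem grzRel_paramRel [Finite F.X] (ι : Type) : GrzRel (F.toQFrame.ParamRel ι) := by
  refine GrzRel.of_finite_up ?_ ?_ ?_ ?_
  · exact fun p => ⟨id, fun x => hr x.1, rfl⟩
  · rintro ⟨w, a⟩ ⟨w', b⟩ ⟨w'', c⟩ ⟨f, hf, hab⟩ ⟨g, hg, hbc⟩
    refine ⟨g ∘ f, fun x => ht _ _ _ (hf x) (hg (f x)), ?_⟩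
    dsimp only at hab hbc ⊢
    rw [Function.comp_assoc, hab, hbc]
  · rintro ⟨w, a⟩ ⟨w', b⟩ ⟨f, hf, hab⟩ ⟨g, hg, hba⟩
    obtain rfl := F.toQFrame_eq_of_hom hr ht ha hf hg
    dsimp only at f hf hab g hg hba
    have : a = b := by
      funext i
      have h₁ : F.R (a i).1 (b i).1 := by rw [← hab]; exact hf (a i)
      have h₂ : F.R (b i).1 (a i).1 := by rw [← hba]; exact hg (b i)
      exact Subtype.ext (ha _ _ h₁ h₂)
    rw [this]
  · rintro ⟨w, a⟩
    have hW : Finite F.toQFrame.W := inferInstanceAs (Finite (Quotient _))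
    have hD : ∀ w, Finite (F.toQFrame.D w) := fun w => inferInstanceAs (Finite (Subtype _))
    refine (Set.finite_range fun p : Σ w', F.toQFrame.D w → F.toQFrame.D w' =>
      (⟨p.1, p.2 ∘ a⟩ : Σ w, ι → F.toQFrame.D w)).subset ?_
    rintro ⟨w', b⟩ ⟨f, -, hab⟩
    dsimp only at f hab
    exact ⟨⟨w', f⟩, by rw [← hab]⟩

omit hr ht ha

/-- The interpretation of the unary predicates given by a valuation of the letters. -/
def toInterp (v : ℕ → Set F.X) (star : ℕ → ℕ) : F.toQFrame.Interp Empty :=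
  fun m k _ _ d => ∃ p, star p = k ∧ ∃ i : Fin m, (d i).1 ∈ v p

theorem sat_toQFrame (v : ℕ → Set F.X) {star : ℕ → ℕ} (hstar : Function.Injective star) (x : ℕ)
    (φ : MonForm) {w : F.toQFrame.W} (a : Empty → F.toQFrame.D w) (s : ℕ → F.toQFrame.D w) :
    QFrame.Sat (F.toInterp v star) w a s (φ.trans x star) ↔ F.Sat v (s x).1 φ := by
  induction φ generalizing w with
  | var p =>
    simp only [MonForm.trans, QFrame.Sat, Sat, toInterp]
    constructor
    · rintro ⟨q, hq, _, h⟩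
      rwa [hstar hq] at h
    · exact fun h => ⟨p, rfl, 0, h⟩
  | neg φ ih => simp only [MonForm.trans, QFrame.Sat, Sat, ih]
  | or φ ψ ih₁ ih₂ => simp only [MonForm.trans, QFrame.Sat, Sat, ih₁, ih₂]
  | dia φ ih =>
    simp only [MonForm.trans, QFrame.Sat, Sat, ih]
    constructor
    · rintro ⟨w', f, hf, h⟩
      exact ⟨_, hf (s x), h⟩
    · rintro ⟨y, hxy, hy⟩
      -- A transition must move the whole cluster: `s x` goes to `y`, and commutation sends every
      -- other element along `R` into the cluster of `y`.
      have hex : ∀ d : F.toQFrame.D w, ∃ d' : F.toQFrame.D (Quotient.mk ⟨F.E, F.equiv⟩ y),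
          F.R d.1 d'.1 ∧ (d = s x → d'.1 = y) := by
        intro d
        by_cases hd : d = s x
        · subst hd
          exact ⟨⟨y, rfl⟩, hxy, fun _ => rfl⟩
        · have hE : F.E d.1 (s x).1 := Quotient.exact (d.2.trans (s x).2.symm)
          obtain ⟨t, hdt, hty⟩ := F.comm _ _ _ hE hxy
          exact ⟨⟨t, Quotient.sound hty⟩, hdt, fun h => absurd h hd⟩
      choose f hf hf' using hex
      refine ⟨_, f, hf, ?_⟩
      have : ((f ∘ s) x).1 = y := hf' _ rfl
      rwa [this]
  | ex φ ih =>
    simp only [MonForm.trans, QFrame.Sat, Sat, ih, Function.update_self]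
    constructor
    · rintro ⟨d, h⟩
      exact ⟨d.1, Quotient.exact ((s x).2.trans d.2.symm), h⟩
    · rintro ⟨y, hxy, hy⟩
      exact ⟨⟨y, (Quotient.sound (F.equiv.symm hxy)).trans (s x).2⟩, hy⟩

end MKFrame

theorem isMonadicFragment_MGrz : IsMonadicFragment MGrz QGrz := by
  intro x star hstar φ
  constructor
  · intro h
    rw [MonForm.trans_eq_inst]
    exact MonProv.predProv_inst h x _
  · intro h
    by_contra hφ
    obtain ⟨F, v, y, hfin, -, hr, ht, ha, hy⟩ := exists_finite_countermodel hφ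
    have := QFrame.sound (F.grzRel_paramRel hr ht ha) h Empty (F.toInterp v star)
      (Quotient.mk ⟨F.E, F.equiv⟩ y) (fun e => e.elim) (fun _ => ⟨y, rfl⟩)
    exact hy ((F.sat_toQFrame v hstar x φ _ _).1 this)

/-! ### Frames in an arbitrary universe -/

/-- The copy of a frame in a higher universe. -/
def MKFrame.lift (F : MKFrame.{0}) : MKFrame.{u} where
  X := ULift F.X
  nonempty := let ⟨x⟩ := F.nonempty; ⟨⟨x⟩⟩
  R x y := F.R x.down y.down
  E x y := F.E x.down y.down
  equiv := ⟨fun x => F.equiv.refl x.down, F.equiv.symm, F.equiv.trans⟩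
  comm _ _ _ hxy hyz := let ⟨t, h₁, h₂⟩ := F.comm _ _ _ hxy hyz; ⟨⟨t⟩, h₁, h₂⟩

theorem MKFrame.sat_lift (F : MKFrame.{0}) (v : ℕ → Set F.X) (φ : MonForm) (x : F.X) :
    (MKFrame.lift.{u} F).Sat (fun p => {y | y.down ∈ v p}) ⟨x⟩ φ ↔ F.Sat v x φ := by
  induction φ generalizing x with
  | var p => rfl
  | neg φ ih => exact not_congr (ih x)
  | or φ ψ ih₁ ih₂ => exact or_congr (ih₁ x) (ih₂ x)
  | dia φ ih =>
    exact ⟨fun ⟨y, h, hy⟩ => ⟨y.down, h, (ih _).1 hy⟩, fun ⟨y, h, hy⟩ => ⟨⟨y⟩, h, (ih _).2 hy⟩⟩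
  | ex φ ih =>
    exact ⟨fun ⟨y, h, hy⟩ => ⟨y.down, h, (ih _).1 hy⟩, fun ⟨y, h, hy⟩ => ⟨⟨y⟩, h, (ih _).2 hy⟩⟩

theorem mem_MGrz_of_valid {φ : MonForm}
    (h : ∀ F : MKFrame.{u}, F.IsFrameOf MGrz → F.Valid φ) : φ ∈ MGrz := by
  by_contra hφ
  obtain ⟨F, v, x, hfin, -, hr, ht, ha, hx⟩ := exists_finite_countermodel hφ
  have hF : GrzRel (MKFrame.lift.{u} F).R := by
    have : Finite (MKFrame.lift.{u} F).X := inferInstanceAs (Finite (ULift F.X))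
    exact GrzRel.of_finite_up (fun x => hr x.down) (fun _ _ _ => ht _ _ _)
      (fun x y h h' => ULift.ext _ _ (ha _ _ h h')) (fun x => Set.toFinite _)
  exact hx ((F.sat_lift v φ x).1 (h _ ((MKFrame.lift F).isFrameOf_MGrz hF) _ _))

theorem mainTheorem2 :
    (∀ φ : MonForm, φ ∈ MGrz ↔ ∀ F : MKFrame.{u}, F.IsFrameOf MGrz → F.Valid φ) ∧
    ComputablePred (fun φ : MonForm => φ ∈ MGrz) ∧
    IsMonadicFragment MGrz QGrz := by
  exact ⟨fun φ => ⟨fun h F hF => hF φ h, mem_MGrz_of_valid⟩, computablePred_mem_MGrz,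
    isMonadicFragment_MGrz⟩
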